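/- Let $p$ be an odd prime, $m\ge 1$ an integer, $q=p^m$, let $K=GF(q^2)$ be a field of order $q^2$, let $\alpha(x)=x^q$ be its automorphism of order $2$, and let $\zeta$ be a primitive element of $K$ (a generator of $K^\times$). Write $\mathbb P^1(K)=K\cup\{\infty\}$ and extend $\alpha$ to $\mathbb P^1(K)$ by $\alpha(\infty)=\infty$. The Zassenhaus group $\mathrm M(q^2)$ is the group of all permutations of $\mathbb P^1(K)$ of the form $\omega\mapsto\frac{a\beta(\omega)+b}{c\beta(\omega)+d}$ with $a,b,c,d\in K$ and $\Delta=ad-bc\ne0$, where $\beta=\mathrm{id}$ if $\Delta\in(K^\times)^2$ and $\beta=\alpha$ otherwise. For a group $G$ and a homomorphism $\varphi:G\to\mathrm{Aut}(G)$ put $g_1\circ_\varphi g_2=g_1\cdot\varphi(g_1)^{-1}(g_2)$; if this operation is associative, then $G_\varphi=(G,\circ_\varphi)$ is a group, the deformation of $G$ by $\varphi$. Let $\bar\varphi:PGL_2(K)\to\mathrm{Aut}(PGL_2(K))$ send the class of a matrix $A$ to the identity if $\det A\in(K^\times)^2$, and otherwise to the automorphism $\bar\alpha$ induced by $\alpha$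 (applied to the matrix entries); the operation $\circ_{\bar\varphi}$ is associative. Then: 1. $\mathrm M(q^2)$ is sharply $3$-transitive on $\mathbb P^1(K)$. 2. Sending the class of $\begin{pmatrix}a&b\\c&d\end{pmatrix}$ to the transformation $\omega\mapsto\frac{a\beta(\omega)+b}{c\beta(\omega)+d}$ is an isomorphism $(PGL_2(K))_{\bar\varphi}\cong\mathrm M(q^2)$. 3. The group $(PGL_2(K))_{\bar\varphi}\cong\mathrm M(q^2)$ is generated by symbols $a,T,J$, corresponding to the classes of $\begin{pmatrix}\zeta^{-1}&0\\0&1\end{pmatrix}$, $\begin{pmatrix}1&-1\\0&-1\end{pmatrix}$, $\begin{pmatrix}0&-1\\-1&0\end{pmatrix}$ respectively, subject to the defining relations $$[J,a]^{\frac{q^2-1}{2}}=1,\qquad a^2=[J,a]^{-\frac{q+1}{2}},\qquad a^{[J,a]}=[J,a]^{q-1}a,\qquad T^2=1,$$ $$T R(\zeta^j)T=R(\zeta^{k_j})\,T\,R\big(\zeta^{\frac{q^2-1}{2}-k_j+j}\big)\quad(1\le j<q^2-1,\ 2\mid k_j),$$ $$T R(\zeta^j)T=R(\zeta^{k_j})\,T\,R\big(\zeta^{\frac{q^2-1}{2}-qk_j+qj}\big)\quad(1\le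 j<q^2-1,\ 2\nmid k_j),$$ $$J^2=(J[J,a])^2=(JT)^3=1.$$ Here $[x,y]=xyx^{-1}y^{-1}$ and $x^y=y^{-1}xy$; $k_j$ is the integer with $1\le k_j<q^2-1$ and $1-\zeta^j=\zeta^{k_j}$; and $R(\zeta^k)$ stands for the word $[J,a]^{\lceil k/2\rceil}a^{\,k-2\lfloor k/2\rfloor}$ for $1\le k<q^2-1$, exponents of $\zeta$ being first reduced modulo $q^2-1$ to this range. -/

import Mathlib

namespace Zassenhaus

open scoped MatrixGroups

/-! ### Deformations of a group -/

section Deformation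

variable {G : Type*} [Group G]

/-- The operation `g₁ ∘_φ g₂ = g₁ · φ(g₁)⁻¹(g₂)` attached to an action `φ` by automorphisms of the
group `G` on itself. -/
def deformedMul (φ : G →* MulAut G) (g₁ g₂ : G) : G := g₁ * (φ g₁)⁻¹ g₂

/-- An action by automorphisms of `G` on itself is admissible if `∘_φ` is associative. -/
class IsAdmissible (φ : G →* MulAut G) : Prop where
  assoc : ∀ g₁ g₂ g₃ : G,
    deformedMul φ (deformedMul φ g₁ g₂) g₃ = deformedMul φ g₁ (deformedMul φ g₂ g₃)

/-- The deformation `G_φ`: a copy of the set `G`, to be equipped with `∘_φ`. For `g : G`,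
`Deformation.of φ g` is `g` regarded as an element of `G_φ`. -/
@[ext]
structure Deformation (φ : G →* MulAut G) where
  /-- Regard an element of `G` as an element of `G_φ`. -/
  of (φ) ::
  /-- Regard an element of `G_φ` as an element of `G`. -/
  val : G

instance (φ : G →* MulAut G) : Mul (Deformation φ) :=
  ⟨fun x y => Deformation.of φ (deformedMul φ x.val y.val)⟩

instance (φ : G →* MulAut G) : One (Deformation φ) := ⟨Deformation.of φ 1⟩

instance (φ : G →* MulAut G) : Inv (Deformation φ) :=
  ⟨fun x => Deformation.of φ (φ x.val x.val)⁻¹⟩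

/-- For admissible `φ`, `G_φ` is a group: the operation is `∘_φ`, the neutral element is that of
`G`, and the inverse of `g` is `φ(g)(g)⁻¹`. -/
instance (φ : G →* MulAut G) [IsAdmissible φ] : Group (Deformation φ) :=
  Group.ofRightAxioms
    (fun x y z => Deformation.ext (IsAdmissible.assoc x.val y.val z.val))
    (fun x => Deformation.ext (by
      change x.val * (φ x.val)⁻¹ 1 = x.val
      rw [map_one, mul_one]))
    (fun x => Deformation.ext (by
      change x.val * (φ x.val)⁻¹ (φ x.val x.val)⁻¹ = 1
      rw [map_inv, MulAut.inv_apply_self, mul_inv_cancel]))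

theorem Deformation.of_mul_of (φ : G →* MulAut G) [IsAdmissible φ] (g₁ g₂ : G) :
    of φ g₁ * of φ g₂ = of φ (g₁ * (φ g₁)⁻¹ g₂) := rfl

end Deformation

/-! ### Squares in a finite field -/

section Squares

variable {K : Type*} [Field K]

theorem isSquare_mul_of_not [Finite K] {u v : Kˣ} (hu : ¬ IsSquare u) (hv : ¬ IsSquare v) :
    IsSquare (u * v) := by
  obtain ⟨g, hg⟩ := IsCyclic.exists_generator (α := Kˣ)
  obtain ⟨i, rfl⟩ := Subgroup.mem_zpowers_iff.1 (hg u)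
  obtain ⟨j, rfl⟩ := Subgroup.mem_zpowers_iff.1 (hg v)
  rw [← zpow_add]
  refine Even.isSquare_zpow ?_ g
  have hi : ¬ Even i := fun h => hu (h.isSquare_zpow g)
  have hj : ¬ Even j := fun h => hv (h.isSquare_zpow g)
  rw [Int.not_even_iff_odd] at hi hj
  exact hi.add_odd hj

open scoped Classical in
/-- The homomorphism `Kˣ → Kˣ/(Kˣ)² → M` (`K` a finite field) sending squares to `1` and
non-squares to the given element `τ` with `τ² = 1`. -/
noncomputable def nonsquareHom [Finite K] {M : Type*} [Monoid M] (τ : M) (hτ : τ * τ = 1) :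
    Kˣ →* M where
  toFun u := if IsSquare u then 1 else τ
  map_one' := if_pos IsSquare.one
  map_mul' u v := by
    by_cases hu : IsSquare u <;> by_cases hv : IsSquare v
    · simp [hu, hv, hu.mul hv]
    · have : ¬ IsSquare (u * v) := fun h => hv (by simpa using hu.inv.mul h)
      simp [hu, hv, this]
    · have : ¬ IsSquare (u * v) := fun h => hu (by simpa using h.mul hv.inv)
      simp [hu, hv, this]
    · simp [hu, hv, isSquare_mul_of_not hu hv, hτ]

end Squares

/-! ### The field of order `q²`, the involution `x ↦ x ^ q`, and the action `φ̄` -/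

section Field

variable {p m : ℕ} [hp : Fact p.Prime] {K : Type*} [Field K]

set_option linter.unusedSectionVars false in
theorem finite_of_card (hK : Nat.card K = (p ^ m) ^ 2) : Finite K :=
  Nat.finite_of_card_ne_zero (by rw [hK]; exact pow_ne_zero _ (pow_ne_zero _ hp.out.ne_zero))

theorem charP_of_card (hK : Nat.card K = (p ^ m) ^ 2) : CharP K p := by
  have := finite_of_card hK
  let _ := Fintype.ofFinite K
  refine charP_of_card_eq_prime_pow (f := m * 2) ?_
  rw [← Nat.card_eq_fintype_card, hK, pow_mul]

/-- The automorphism `α : x ↦ x ^ q` of a field `K` of order `q²`, where `q = p ^ m`: the `m`-th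
power of the Frobenius automorphism. -/
noncomputable def conj (hK : Nat.card K = (p ^ m) ^ 2) : K ≃+* K :=
  haveI := finite_of_card hK
  haveI := charP_of_card hK
  iterateFrobeniusEquiv K p m

theorem conj_apply (hK : Nat.card K = (p ^ m) ^ 2) (x : K) : conj hK x = x ^ p ^ m := by
  have := finite_of_card hK
  have := charP_of_card hK
  exact iterateFrobenius_def p m x

theorem conj_conj (hK : Nat.card K = (p ^ m) ^ 2) (x : K) : conj hK (conj hK x) = x := by
  have := finite_of_card hK
  let _ := Fintype.ofFinite K
  rw [conj_apply, conj_apply, ← pow_mul, ← sq, ← hK, Nat.card_eq_fintype_card,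
    FiniteField.pow_card]

/-- The automorphism of `GL₂(K)` induced by `α` (entrywise). -/
noncomputable def conjGL (hK : Nat.card K = (p ^ m) ^ 2) : MulAut (GL (Fin 2) K) where
  toFun := Matrix.GeneralLinearGroup.map (conj hK : K →+* K)
  invFun := Matrix.GeneralLinearGroup.map (conj hK : K →+* K)
  left_inv A := by ext i j; simp [conj_conj]
  right_inv A := by ext i j; simp [conj_conj]
  map_mul' := map_mul _

theorem conjGL_apply (hK : Nat.card K = (p ^ m) ^ 2) (A : GL (Fin 2) K) :
    conjGL hK A = Matrix.GeneralLinearGroup.map (conj hK : K →+* K) A := rfl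

theorem conjGL_conjGL (hK : Nat.card K = (p ^ m) ^ 2) (A : GL (Fin 2) K) :
    conjGL hK (conjGL hK A) = A := (conjGL hK).left_inv A

/-- The automorphism `ᾱ` of `PGL₂(K)` induced by `α`. -/
noncomputable def conjPGL (hK : Nat.card K = (p ^ m) ^ 2) : MulAut PGL(2, K) :=
  QuotientGroup.congr (Subgroup.center (GL (Fin 2) K)) (Subgroup.center (GL (Fin 2) K))
    (conjGL hK) (Subgroup.characteristic_iff_map_eq.1 inferInstance (conjGL hK))

theorem conjPGL_mk (hK : Nat.card K = (p ^ m) ^ 2) (A : GL (Fin 2) K) :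
    conjPGL hK (Matrix.ProjGenLinGroup.mk A) = Matrix.ProjGenLinGroup.mk (conjGL hK A) := rfl

theorem conjPGL_mul_self (hK : Nat.card K = (p ^ m) ^ 2) : conjPGL hK * conjPGL hK = 1 := by
  ext x
  induction x using Matrix.ProjGenLinGroup.induction_on with
  | mk A => rw [MulAut.mul_apply, conjPGL_mk, conjPGL_mk, conjGL_conjGL, MulAut.one_apply]

/-- The action `φ̄ : PGL₂(K) → Aut(PGL₂(K))`: the class of a matrix acts trivially if the
determinant is a square in `Kˣ`, and as `ᾱ` otherwise (see `phiBar_mk`). -/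
noncomputable def phiBar (hK : Nat.card K = (p ^ m) ^ 2) : PGL(2, K) →* MulAut PGL(2, K) :=
  haveI := finite_of_card hK
  QuotientGroup.lift (Subgroup.center (GL (Fin 2) K))
    ((nonsquareHom (conjPGL hK) (conjPGL_mul_self hK)).comp Matrix.GeneralLinearGroup.det)
    (by
      intro A hA
      rw [Matrix.GeneralLinearGroup.center_eq_range_scalar] at hA
      obtain ⟨u, rfl⟩ := hA
      refine if_pos ⟨u, ?_⟩
      ext
      simp [sq])

open scoped Classical in
theorem phiBar_mk (hK : Nat.card K = (p ^ m) ^ 2) (A : GL (Fin 2) K) :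
    phiBar hK (Matrix.ProjGenLinGroup.mk A) =
      if IsSquare (Matrix.GeneralLinearGroup.det A) then 1 else conjPGL hK := rfl

theorem isSquare_map_conj (hK : Nat.card K = (p ^ m) ^ 2) (A : GL (Fin 2) K) :
    IsSquare (Matrix.GeneralLinearGroup.det (conjGL hK A)) ↔
      IsSquare (Matrix.GeneralLinearGroup.det A) := by
  have key : ∀ B : GL (Fin 2) K, IsSquare (Matrix.GeneralLinearGroup.det B) →
      IsSquare (Matrix.GeneralLinearGroup.det (conjGL hK B)) := by
    intro B hB
    have : Matrix.GeneralLinearGroup.det (conjGL hK B)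
        = Units.map (conj hK : K →* K) (Matrix.GeneralLinearGroup.det B) := by
      ext
      simp [conjGL_apply, Matrix.det_fin_two]
    rw [this]
    exact hB.map _
  exact ⟨fun h => by simpa only [conjGL_conjGL] using key _ h, key A⟩

/-- `φ̄` is admissible. -/
instance (hK : Nat.card K = (p ^ m) ^ 2) : IsAdmissible (phiBar hK) where
  assoc x y z := by
    have h1 : ∀ w : PGL(2, K), phiBar hK w = 1 ∨ phiBar hK w = conjPGL hK := by
      intro w
      induction w using Matrix.ProjGenLinGroup.induction_on with
      | mk A => rw [phiBar_mk]; split_ifs <;> simp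
    have h2 : ∀ w : PGL(2, K), phiBar hK (conjPGL hK w) = phiBar hK w := by
      intro w
      induction w using Matrix.ProjGenLinGroup.induction_on with
      | mk A =>
        rw [conjPGL_mk, phiBar_mk, phiBar_mk]
        by_cases h : IsSquare (Matrix.GeneralLinearGroup.det A)
        · rw [if_pos h, if_pos ((isSquare_map_conj hK A).2 h)]
        · rw [if_neg h, if_neg (fun h' => h ((isSquare_map_conj hK A).1 h'))]
    have h3 : (conjPGL hK)⁻¹ = conjPGL hK := inv_eq_of_mul_eq_one_left (conjPGL_mul_self hK)
    have h4 : phiBar hK ((phiBar hK x)⁻¹ y) = phiBar hK y := by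
      rcases h1 x with h | h <;> rw [h]
      · simp
      · rw [h3, h2]
    have h5 : phiBar hK x * phiBar hK y = phiBar hK y * phiBar hK x := by
      rcases h1 x with h | h <;> rcases h1 y with h' | h' <;> rw [h, h'] <;> simp
    simp only [deformedMul, map_mul, h4, h5, mul_inv_rev, MulAut.mul_apply, mul_assoc]

/-! ### The Zassenhaus group `M(q²)` as a permutation group of the projective line -/

open scoped Classical in
/-- The extension to `ℙ¹(K) = K ∪ {∞}` of the field automorphism `β` attached to `A`: it is the
identity if `det A` is a square in `Kˣ`, and otherwise it is `α`, extended by `α(∞) = ∞`. -/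
noncomputable def beta (hK : Nat.card K = (p ^ m) ^ 2) (A : GL (Fin 2) K) (ω : OnePoint K) :
    OnePoint K :=
  if IsSquare (Matrix.GeneralLinearGroup.det A) then ω else OnePoint.map (conj hK) ω

open scoped Classical in
/-- The transformation `ω ↦ (a β(ω) + b) / (c β(ω) + d)` of `ℙ¹(K)` attached to an invertible
matrix `A = !![a, b; c, d]`; here `•` is the usual action by Möbius transformations. -/
noncomputable def semiMoebius (hK : Nat.card K = (p ^ m) ^ 2) (A : GL (Fin 2) K)
    (ω : OnePoint K) : OnePoint K :=
  A • beta hK A ω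

theorem semiMoebius_one (hK : Nat.card K = (p ^ m) ^ 2) (ω : OnePoint K) :
    semiMoebius hK 1 ω = ω := by
  simp [semiMoebius, beta]

open scoped Classical in
theorem exists_semiMoebius_comp (hK : Nat.card K = (p ^ m) ^ 2) (A B : GL (Fin 2) K) :
    ∃ C : GL (Fin 2) K, ∀ ω, semiMoebius hK A (semiMoebius hK B ω) = semiMoebius hK C ω := by
  have := finite_of_card hK
  have hmap : ∀ (D : GL (Fin 2) K) (ω : OnePoint K),
      OnePoint.map (conj hK) (D • ω) = conjGL hK D • OnePoint.map (conj hK) ω :=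
    fun D ω => OnePoint.map_smul (conj hK : K →+* K) D ω
  have hinv : ∀ ω : OnePoint K, OnePoint.map (conj hK) (OnePoint.map (conj hK) ω) = ω := by
    intro ω
    cases ω <;> simp [conj_conj]
  have hdet := isSquare_map_conj hK B
  by_cases hA : IsSquare (Matrix.GeneralLinearGroup.det A) <;>
    by_cases hB : IsSquare (Matrix.GeneralLinearGroup.det B)
  · refine ⟨A * B, fun ω => ?_⟩
    have : IsSquare (Matrix.GeneralLinearGroup.det (A * B)) := by
      rw [map_mul]; exact hA.mul hB
    simp only [semiMoebius, beta, if_pos hA, if_pos hB, if_pos this, mul_smul]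
  · refine ⟨A * B, fun ω => ?_⟩
    have : ¬ IsSquare (Matrix.GeneralLinearGroup.det (A * B)) := by
      rw [map_mul]
      exact fun h => hB (by simpa using hA.inv.mul h)
    simp only [semiMoebius, beta, if_pos hA, if_neg hB, if_neg this, mul_smul]
  · refine ⟨A * conjGL hK B, fun ω => ?_⟩
    have : ¬ IsSquare (Matrix.GeneralLinearGroup.det (A * conjGL hK B)) := by
      rw [map_mul]
      exact fun h => hA (by simpa using h.mul (hdet.2 hB).inv)
    simp only [semiMoebius, beta, if_neg hA, if_pos hB, if_neg this, mul_smul, hmap]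
  · refine ⟨A * conjGL hK B, fun ω => ?_⟩
    have : IsSquare (Matrix.GeneralLinearGroup.det (A * conjGL hK B)) := by
      rw [map_mul]
      exact isSquare_mul_of_not hA (fun h => hB (hdet.1 h))
    simp only [semiMoebius, beta, if_neg hA, if_neg hB, if_pos this, mul_smul, hmap, hinv]

open scoped Classical in
theorem exists_semiMoebius_leftInv (hK : Nat.card K = (p ^ m) ^ 2) (A : GL (Fin 2) K) :
    ∃ C : GL (Fin 2) K, ∀ ω, semiMoebius hK C (semiMoebius hK A ω) = ω := by
  have hmap : ∀ (D : GL (Fin 2) K) (ω : OnePoint K),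
      OnePoint.map (conj hK) (D • ω) = conjGL hK D • OnePoint.map (conj hK) ω :=
    fun D ω => OnePoint.map_smul (conj hK : K →+* K) D ω
  have hinv : ∀ ω : OnePoint K, OnePoint.map (conj hK) (OnePoint.map (conj hK) ω) = ω := by
    intro ω
    cases ω <;> simp [conj_conj]
  by_cases hA : IsSquare (Matrix.GeneralLinearGroup.det A)
  · refine ⟨A⁻¹, fun ω => ?_⟩
    have : IsSquare (Matrix.GeneralLinearGroup.det A⁻¹) := by rw [map_inv]; exact hA.inv
    simp only [semiMoebius, beta, if_pos hA, if_pos this, inv_smul_smul]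
  · refine ⟨conjGL hK A⁻¹, fun ω => ?_⟩
    have : ¬ IsSquare (Matrix.GeneralLinearGroup.det (conjGL hK A⁻¹)) := by
      rw [isSquare_map_conj, map_inv]
      exact fun h => hA (by simpa using h.inv)
    simp only [semiMoebius, beta, if_neg hA, if_neg this, hmap, hinv]
    rw [← mul_smul, ← map_mul, inv_mul_cancel, map_one, one_smul]

/-- The Zassenhaus group `M(q²)`: the group of all permutations of `ℙ¹(K)` of the form
`ω ↦ (a β(ω) + b) / (c β(ω) + d)` with `ad - bc ≠ 0`. -/
def M (hK : Nat.card K = (p ^ m) ^ 2) : Subgroup (Equiv.Perm (OnePoint K)) where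
  carrier := {h | ∃ A : GL (Fin 2) K, ∀ ω, h ω = semiMoebius hK A ω}
  one_mem' := ⟨1, fun ω => (semiMoebius_one hK ω).symm⟩
  mul_mem' := by
    rintro g h ⟨A, hA⟩ ⟨B, hB⟩
    obtain ⟨C, hC⟩ := exists_semiMoebius_comp hK A B
    exact ⟨C, fun ω => by rw [Equiv.Perm.mul_apply, hA, hB, hC]⟩
  inv_mem' := by
    rintro g ⟨A, hA⟩
    obtain ⟨C, hC⟩ := exists_semiMoebius_leftInv hK A
    refine ⟨C, fun ω => ?_⟩
    have := hC (g⁻¹ ω)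
    rw [← hA, ← Equiv.Perm.mul_apply, mul_inv_cancel, Equiv.Perm.one_apply] at this
    exact this.symm

end Field

/-- A permutation group on `Ω` is sharply `3`-transitive if any triple of distinct points is
carried to any other such triple by exactly one element of the group. -/
def IsSharplyThreeTransitive {Ω : Type*} (G : Subgroup (Equiv.Perm Ω)) : Prop :=
  ∀ x y : Fin 3 → Ω, Function.Injective x → Function.Injective y →
    ∃! g : Equiv.Perm Ω, g ∈ G ∧ ∀ i, g (x i) = y i

/-! ### The presentation -/

/-- The three generating symbols. -/
inductive Gen
  | a
  | T
  | J

namespace Gen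

/-- The free generator `a`. -/
def wa : FreeGroup Gen := FreeGroup.of Gen.a

/-- The free generator `T`. -/
def wT : FreeGroup Gen := FreeGroup.of Gen.T

/-- The free generator `J`. -/
def wJ : FreeGroup Gen := FreeGroup.of Gen.J

/-- The commutator `[J, a] = J a J⁻¹ a⁻¹`. -/
def wb : FreeGroup Gen := wJ * wa * wJ⁻¹ * wa⁻¹

/-- The word `[J, a] ^ ⌈k / 2⌉ * a ^ (k - 2 ⌊k / 2⌋)`. -/
def wR (k : ℕ) : FreeGroup Gen := wb ^ ((k + 1) / 2) * wa ^ (k - 2 * (k / 2))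

/-- The word that `R(ζ ^ e)` stands for, where `ζ` has order `q² - 1` and `e` is any integer: the
exponent is first reduced modulo `q² - 1`. -/
def wRζ (q : ℕ) (e : ℤ) : FreeGroup Gen := wR (e % ((q : ℤ) ^ 2 - 1)).toNat

end Gen

open Gen

/-- The relators `l * r⁻¹` of the relations `l = r` of the presentation; `k` is the index
`k_j` determined by `j` through `1 - ζ ^ j = ζ ^ k` and `1 ≤ k < q² - 1`, and `x ^ y = y⁻¹ x y`. -/
def relators {K : Type*} [Field K] (q : ℕ) (ζ : Kˣ) : Set (FreeGroup Gen) :=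
  { wb ^ ((q ^ 2 - 1) / 2),
    wa ^ 2 * (wb⁻¹ ^ ((q + 1) / 2))⁻¹,
    (wb⁻¹ * wa * wb) * (wb ^ (q - 1) * wa)⁻¹,
    wT ^ 2,
    wJ ^ 2,
    (wJ * wb) ^ 2,
    (wJ * wT) ^ 3 } ∪
  { w | ∃ j k : ℕ, 1 ≤ j ∧ j < q ^ 2 - 1 ∧ 1 ≤ k ∧ k < q ^ 2 - 1 ∧
      1 - (ζ : K) ^ j = (ζ : K) ^ k ∧ Even k ∧
      w = (wT * wRζ q j * wT) *
        (wRζ q k * wT * wRζ q (((q : ℤ) ^ 2 - 1) / 2 - k + j))⁻¹ } ∪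
  { w | ∃ j k : ℕ, 1 ≤ j ∧ j < q ^ 2 - 1 ∧ 1 ≤ k ∧ k < q ^ 2 - 1 ∧
      1 - (ζ : K) ^ j = (ζ : K) ^ k ∧ ¬ Even k ∧
      w = (wT * wRζ q j * wT) *
        (wRζ q k * wT * wRζ q (((q : ℤ) ^ 2 - 1) / 2 - q * k + q * j))⁻¹ }

/-- The matrix `R(u) = !![u, 0; 0, 1]`. -/
def matR {K : Type*} [Field K] (u : Kˣ) : GL (Fin 2) K :=
  Matrix.GeneralLinearGroup.mkOfDetNeZero !![(u : K), 0; 0, 1] (by simp [Matrix.det_fin_two])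

/-- The matrix `!![1, -1; 0, -1]`. -/
def matT (K : Type*) [Field K] : GL (Fin 2) K :=
  Matrix.GeneralLinearGroup.mkOfDetNeZero !![(1 : K), -1; 0, -1] (by simp [Matrix.det_fin_two])

/-- The matrix `!![0, -1; -1, 0]`. -/
def matJ (K : Type*) [Field K] : GL (Fin 2) K :=
  Matrix.GeneralLinearGroup.mkOfDetNeZero !![(0 : K), -1; -1, 0] (by simp [Matrix.det_fin_two])

end Zassenhaus

namespace Zassenhaus

/-! Everything is compared inside the permutations of `ℙ¹(K)`. With `A` and `B` the matrices of two
transformations, moving `β` past `B` replaces `B` by its conjugate exactly when `det A` is a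
non-square, so composition of semilinear transformations is the product `∘` for `φ̄`
(`semiPerm_mul`). Scalars act trivially, and only scalars fix `∞`, `0`, `1`
(`exists_scalar_of_fixes`). This gives the isomorphism from the deformation to `M(q²)`, and also the
uniqueness half of sharp 3-transitivity. Existence uses only `R(u)`, `T : x ↦ 1 - x` and `J : x ↦
1/x` (`exists_mem_map_to_standard`), so these also generate `M(q²)`.

For the presentation, write `q = 2h + 1`, so that `q² - 1 = 4h(h+1)`. Checking each relator
pointwise gives a homomorphism from the presented group to the permutations (`lift_relator`), whose
image is `M(q²)` because it contains `R(u)`, `T` and `J`.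

Injectivity rests on a Bruhat decomposition derived from the relations alone. The words `R(ζ^e)` are
closed under multiplication. The relations for `T R(ζ^j) T` make the forms `h` and `h T h'` stable
under left multiplication by `T`, and `JTJ = TJT` together with `J h J` being a torus word does the
same for `x` and `x J y` under `J` (`isBruhat_presentedGroup`). Uniqueness of normal forms is not
needed: a form acting trivially is excluded or shown trivial by its effect on one of `∞`, `0`, `1`
(`presentedPerm_injective`). -/

/-! ### Groups satisfying the relations: normal forms -/

section NormalForm

variable {G : Type*} [Group G]

/-- The element `b ^ ⌈e / 2⌉ * a ^ (e - 2 ⌊e / 2⌋)`. -/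
def torusElt (b a : G) (e : ℤ) : G := b ^ ((e + 1) / 2) * a ^ (e % 2)

/-- The consequences of the relations of the presentation, for `q = 2 h + 1`, that lead to normal
forms; `b` stands for `[J, a]`. -/
structure ZRelations (h : ℤ) (b a T J : G) : Prop where
  b_pow : b ^ (2 * h * (h + 1)) = 1
  a_sq : a * a = b ^ (-(h + 1))
  a_mul_b : a * b = b ^ (2 * h + 1) * a
  T_sq : T * T = 1
  J_sq : J * J = 1
  J_conj_b : J * b * J = b⁻¹
  J_conj_a : J * a * J = b * a
  JTJ : J * T * J = T * J * T
  -- Only the shape of the right side matters for reducing words; the exact exponents matter only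
  -- when the relation is verified in `M(q²)`.
  T_conj : ∀ e : ℤ, 0 < e → e < 4 * h * (h + 1) →
    ∃ k l : ℤ, T * torusElt b a e * T = torusElt b a k * T * torusElt b a l

theorem torusElt_even (b a : G) (i : ℤ) : torusElt b a (2 * i) = b ^ i := by
  have h1 : (2 * i + 1) / 2 = i := by omega
  have h2 : (2 * i) % 2 = 0 := by omega
  simp [torusElt, h1, h2]

theorem torusElt_odd (b a : G) (i : ℤ) : torusElt b a (2 * i + 1) = b ^ (i + 1) * a := by
  have h1 : (2 * i + 1 + 1) / 2 = i + 1 := by omega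
  have h2 : (2 * i + 1) % 2 = 1 := by omega
  simp [torusElt, h1, h2]

theorem torusElt_zero (b a : G) : torusElt b a 0 = 1 := by simp [torusElt]

theorem torusElt_even_mul (b a : G) (i f : ℤ) :
    torusElt b a (2 * i) * torusElt b a f = torusElt b a (2 * i + f) := by
  rw [torusElt_even]
  obtain ⟨j, rfl | rfl⟩ := Int.even_or_odd' f
  · rw [torusElt_even, ← mul_add, torusElt_even, zpow_add]
  · rw [torusElt_odd, ← add_assoc, ← mul_add, torusElt_odd, ← mul_assoc, ← zpow_add, add_assoc]

theorem torusElt_neg_one (b a : G) : torusElt b a (-1) = a := by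
  simpa using torusElt_odd b a (-1)

namespace ZRelations

variable {h : ℤ} {b a T J : G}

theorem b_zpow_mul (H : ZRelations h b a T J) (n : ℤ) : b ^ (2 * h * (h + 1) * n) = 1 := by
  rw [zpow_mul, H.b_pow, one_zpow]

theorem a_mul_b_zpow (H : ZRelations h b a T J) (n : ℤ) : a * b ^ n = b ^ ((2 * h + 1) * n) * a := by
  have h1 : a * b * a⁻¹ = b ^ (2 * h + 1) := by rw [H.a_mul_b, mul_inv_cancel_right]
  rw [zpow_mul, ← h1, conj_zpow, inv_mul_cancel_right]

/-- `a b = b ^ q a`, so carrying `a` past a power of `b` multiplies the exponent by `q`; when two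
letters `a` meet, `a² = b ^ (-(h+1))` absorbs them. Together with the even case this is the law of
the twisted torus: `e` and `f` combine to `e + f` or `e + q f` according to the parity of `e`. -/
theorem torusElt_odd_mul (H : ZRelations h b a T J) (i f : ℤ) :
    torusElt b a (2 * i + 1) * torusElt b a f =
      torusElt b a (2 * i + 1 + (2 * h + 1) * f) := by
  rw [torusElt_odd]
  obtain ⟨j, rfl | rfl⟩ := Int.even_or_odd' f
  · rw [torusElt_even, show 2 * i + 1 + (2 * h + 1) * (2 * j) = 2 * (i + (2 * h + 1) * j) + 1 by ring,
      torusElt_odd, mul_assoc, H.a_mul_b_zpow, ← mul_assoc, ← zpow_add]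
    congr 2
    ring
  · rw [torusElt_odd,
      show 2 * i + 1 + (2 * h + 1) * (2 * j + 1) = 2 * (i + (2 * h + 1) * j + h + 1) by ring,
      torusElt_even, mul_assoc, ← mul_assoc a, H.a_mul_b_zpow, mul_assoc _ a, H.a_sq, ← zpow_add,
      ← zpow_add]
    congr 1
    ring

theorem exists_torusElt_mul (H : ZRelations h b a T J) (e f : ℤ) :
    ∃ g, torusElt b a e * torusElt b a f = torusElt b a g := by
  obtain ⟨i, rfl | rfl⟩ := Int.even_or_odd' e
  · exact ⟨_, torusElt_even_mul b a i f⟩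
  · exact ⟨_, H.torusElt_odd_mul i f⟩

theorem torusElt_add_mul (H : ZRelations h b a T J) (e n : ℤ) :
    torusElt b a (e + 4 * h * (h + 1) * n) = torusElt b a e := by
  rw [add_comm, show 4 * h * (h + 1) * n = 2 * (2 * h * (h + 1) * n) by ring,
    ← torusElt_even_mul, torusElt_even, H.b_zpow_mul, one_mul]

theorem torusElt_emod (H : ZRelations h b a T J) (e : ℤ) :
    torusElt b a (e % (4 * h * (h + 1))) = torusElt b a e := by
  conv_rhs => rw [← Int.emod_add_mul_ediv e (4 * h * (h + 1)), H.torusElt_add_mul]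

theorem torusElt_of_dvd (H : ZRelations h b a T J) {e : ℤ} (he : 4 * h * (h + 1) ∣ e) :
    torusElt b a e = 1 := by
  obtain ⟨n, rfl⟩ := he
  rw [← zero_add (_ * n), H.torusElt_add_mul, torusElt_zero]

theorem exists_T_conj_torusElt (H : ZRelations h b a T J) (hh : 0 < h) {e : ℤ}
    (he : ¬ (4 * h * (h + 1) ∣ e)) :
    ∃ k l : ℤ, T * torusElt b a e * T = torusElt b a k * T * torusElt b a l := by
  have hpos : 0 < 4 * h * (h + 1) := by positivity
  have hne : e % (4 * h * (h + 1)) ≠ 0 := fun h0 => he (Int.dvd_of_emod_eq_zero h0)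
  rw [← H.torusElt_emod]
  exact H.T_conj _ (lt_of_le_of_ne (Int.emod_nonneg e hpos.ne') hne.symm)
    (Int.emod_lt_of_pos e hpos)

theorem exists_torusElt_eq_inv (H : ZRelations h b a T J) :
    ∃ e, torusElt b a e = a⁻¹ := by
  -- As `a` has exponent `-1`, the twisted law combines it with exponent `q` to `-1 + q * q = q² -
  -- 1`, which is trivial.
  refine ⟨2 * h + 1, (inv_eq_of_mul_eq_one_right ?_).symm⟩
  nth_rw 1 [← torusElt_neg_one b a]
  rw [show (-1 : ℤ) = 2 * (-1) + 1 by norm_num, H.torusElt_odd_mul]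
  exact H.torusElt_of_dvd ⟨1, by ring⟩

/-- `J` inverts `b` and sends `a` to `b a`, so conjugation by `J` negates the exponent. -/
theorem exists_J_conj_torusElt (H : ZRelations h b a T J) (e : ℤ) :
    ∃ f, J * torusElt b a e * J = torusElt b a f := by
  have hJ : J⁻¹ = J := inv_eq_of_mul_eq_one_left H.J_sq
  have hb : ∀ i : ℤ, J * b ^ i * J = b ^ (-i) := by
    intro i
    have := conj_zpow (i := i) (a := J) (b := b)
    rw [hJ, H.J_conj_b, inv_zpow'] at this
    exact this.symm
  obtain ⟨i, rfl | rfl⟩ := Int.even_or_odd' e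
  · exact ⟨2 * (-i), by rw [torusElt_even, torusElt_even, hb]⟩
  · refine ⟨2 * (-(i + 1)) + 1, ?_⟩
    rw [torusElt_odd, torusElt_odd]
    calc J * (b ^ (i + 1) * a) * J = J * b ^ (i + 1) * (J * J) * a * J := by
          rw [H.J_sq]; group
      _ = (J * b ^ (i + 1) * J) * (J * a * J) := by group
      _ = _ := by rw [hb, H.J_conj_a, ← mul_assoc, zpow_add_one]

end ZRelations

/-! ### Borel and Bruhat normal forms -/

/-- The normal forms `h` and `h T h'` of the stabilizer of `∞`. -/
def IsBorel (b a T g : G) : Prop :=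
  (∃ e, g = torusElt b a e) ∨ ∃ e f, g = torusElt b a e * T * torusElt b a f

/-- The normal forms `g` and `g J g'`, with `g, g'` in the stabilizer of `∞`. -/
def IsBruhat (b a T J g : G) : Prop :=
  IsBorel b a T g ∨ ∃ x y, IsBorel b a T x ∧ IsBorel b a T y ∧ g = x * J * y

variable {h : ℤ} {b a T J : G}

theorem IsBorel.torusElt_mul {g : G} (H : ZRelations h b a T J)
    (hg : IsBorel b a T g) (e : ℤ) :
    IsBorel b a T (torusElt b a e * g) := by
  obtain ⟨f, rfl⟩ | ⟨f, k, rfl⟩ := hg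
  · obtain ⟨l, hl⟩ := H.exists_torusElt_mul e f
    exact Or.inl ⟨l, hl⟩
  · obtain ⟨l, hl⟩ := H.exists_torusElt_mul e f
    exact Or.inr ⟨l, k, by rw [← mul_assoc, ← mul_assoc, hl]⟩

theorem IsBorel.T_mul {g : G} (H : ZRelations h b a T J) (hh : 0 < h)
    (hg : IsBorel b a T g) :
    IsBorel b a T (T * g) := by
  obtain ⟨f, rfl⟩ | ⟨e, f, rfl⟩ := hg
  · exact Or.inr ⟨0, f, by rw [torusElt_zero, one_mul]⟩
  -- The conjugation relations exclude the trivial torus element; there the two letters `T` cancel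
  -- instead.
  · by_cases he : 4 * h * (h + 1) ∣ e
    · refine Or.inl ⟨f, ?_⟩
      rw [H.torusElt_of_dvd he, one_mul, ← mul_assoc, H.T_sq, one_mul]
    · obtain ⟨k, l, hkl⟩ := H.exists_T_conj_torusElt hh he
      obtain ⟨n, hn⟩ := H.exists_torusElt_mul l f
      refine Or.inr ⟨k, n, ?_⟩
      rw [← hn, ← mul_assoc, ← mul_assoc, hkl, mul_assoc (_ * T)]

theorem IsBruhat.torusElt_mul {g : G} (H : ZRelations h b a T J)
    (hg : IsBruhat b a T J g) (e : ℤ) :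
    IsBruhat b a T J (torusElt b a e * g) := by
  obtain hg | ⟨x, y, hx, hy, rfl⟩ := hg
  · exact Or.inl (hg.torusElt_mul H e)
  · exact Or.inr ⟨_, y, hx.torusElt_mul H e, hy, by simp only [mul_assoc]⟩

theorem IsBruhat.T_mul {g : G} (H : ZRelations h b a T J) (hh : 0 < h)
    (hg : IsBruhat b a T J g) :
    IsBruhat b a T J (T * g) := by
  obtain hg | ⟨x, y, hx, hy, rfl⟩ := hg
  · exact Or.inl (hg.T_mul H hh)
  · exact Or.inr ⟨_, y, hx.T_mul H hh, hy, by simp only [mul_assoc]⟩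

theorem IsBruhat.J_mul {g : G} (H : ZRelations h b a T J) (hh : 0 < h)
    (hg : IsBruhat b a T J g) :
    IsBruhat b a T J (J * g) := by
  obtain hg | ⟨x, y, hx, hy, rfl⟩ := hg
  · exact Or.inr ⟨1, g, Or.inl ⟨0, (torusElt_zero b a).symm⟩, hg, by rw [one_mul]⟩
  · obtain ⟨e, rfl⟩ | ⟨e, f, rfl⟩ := hx
    · obtain ⟨k, hk⟩ := H.exists_J_conj_torusElt e
      rw [← mul_assoc, ← mul_assoc, hk]
      exact Or.inl (hy.torusElt_mul H k)
    -- Inserting `J² = 1` on both sides of `T` turns `J (h T h') J` into `(J h J)(J T J)(J h' J)`.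
    -- The braid relation `JTJ = TJT` then leaves a single `J`, with Borel elements on either side.
    · obtain ⟨k, hk⟩ := H.exists_J_conj_torusElt e
      obtain ⟨l, hl⟩ := H.exists_J_conj_torusElt f
      refine Or.inr ⟨torusElt b a k * T, T * (torusElt b a l * y), Or.inr ⟨k, 0, ?_⟩,
        (hy.torusElt_mul H l).T_mul H hh, ?_⟩
      · rw [torusElt_zero, mul_one]
      · rw [← hk, ← hl]
        calc _ = J * torusElt b a e * (J * J) * T * (J * J) * torusElt b a f * J * y := by
              rw [H.J_sq]; simp only [mul_assoc, mul_one]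
          _ = J * torusElt b a e * J * (J * T * J) * J * torusElt b a f * J * y := by
              simp only [mul_assoc]
          _ = _ := by rw [H.JTJ]; simp only [mul_assoc]

end NormalForm

open scoped MatrixGroups OnePoint

/-! ### The semilinear transformations as permutations -/

section Perm

variable {p m : ℕ} [hp : Fact p.Prime] {K : Type*} [Field K]

theorem semiMoebius_injective (hK : Nat.card K = (p ^ m) ^ 2) (A : GL (Fin 2) K) :
    Function.Injective (semiMoebius hK A) := by
  obtain ⟨C, hC⟩ := exists_semiMoebius_leftInv hK A
  exact Function.LeftInverse.injective hC

/-- The transformation attached to an invertible matrix, as a permutation. -/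
noncomputable def semiPerm (hK : Nat.card K = (p ^ m) ^ 2) (A : GL (Fin 2) K) :
    Equiv.Perm (OnePoint K) :=
  Equiv.ofBijective (semiMoebius hK A) <| by
    have := finite_of_card hK
    have : Finite (OnePoint K) := inferInstanceAs (Finite (Option K))
    exact Finite.injective_iff_bijective.1 (semiMoebius_injective hK A)

theorem semiPerm_apply (hK : Nat.card K = (p ^ m) ^ 2) (A : GL (Fin 2) K) (ω : OnePoint K) :
    semiPerm hK A ω = semiMoebius hK A ω := rfl

theorem semiPerm_mem_M (hK : Nat.card K = (p ^ m) ^ 2) (A : GL (Fin 2) K) :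
    semiPerm hK A ∈ M hK := ⟨A, fun _ => rfl⟩

theorem mem_M_iff (hK : Nat.card K = (p ^ m) ^ 2) {g : Equiv.Perm (OnePoint K)} :
    g ∈ M hK ↔ ∃ A, semiPerm hK A = g :=
  ⟨fun ⟨A, hA⟩ => ⟨A, Equiv.ext fun ω => (hA ω).symm⟩,
    fun ⟨A, hA⟩ => hA ▸ semiPerm_mem_M hK A⟩

open scoped Classical in
-- `α(B • ω) = α(B) • α(ω)`, conjugation preserves the square class of the determinant, square
-- classes multiply, and `α² = 1`; hence the field automorphisms compose as the product matrix
-- prescribes.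
theorem semiPerm_mul (hK : Nat.card K = (p ^ m) ^ 2) (A B : GL (Fin 2) K) :
    semiPerm hK A * semiPerm hK B =
      semiPerm hK (A * if IsSquare (Matrix.GeneralLinearGroup.det A) then B else conjGL hK B) := by
  have := finite_of_card hK
  have hmap : ∀ (D : GL (Fin 2) K) (ω : OnePoint K),
      OnePoint.map (conj hK) (D • ω) = conjGL hK D • OnePoint.map (conj hK) ω :=
    fun D ω => OnePoint.map_smul (conj hK : K →+* K) D ω
  have hinv : ∀ ω : OnePoint K, OnePoint.map (conj hK) (OnePoint.map (conj hK) ω) = ω := by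
    intro ω
    cases ω <;> simp [conj_conj]
  have hdet := isSquare_map_conj hK B
  ext1 ω
  rw [Equiv.Perm.mul_apply]
  simp only [semiPerm_apply]
  by_cases hA : IsSquare (Matrix.GeneralLinearGroup.det A) <;>
    by_cases hB : IsSquare (Matrix.GeneralLinearGroup.det B)
  · have : IsSquare (Matrix.GeneralLinearGroup.det (A * B)) := by
      rw [map_mul]; exact hA.mul hB
    simp only [semiMoebius, beta, if_pos hA, if_pos hB, if_pos this, mul_smul]
  · have : ¬ IsSquare (Matrix.GeneralLinearGroup.det (A * B)) := by
      rw [map_mul]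
      exact fun h => hB (by simpa using hA.inv.mul h)
    simp only [semiMoebius, beta, if_pos hA, if_neg hB, if_neg this, mul_smul]
  · have : ¬ IsSquare (Matrix.GeneralLinearGroup.det (A * conjGL hK B)) := by
      rw [map_mul]
      exact fun h => hA (by simpa using h.mul (hdet.2 hB).inv)
    simp only [semiMoebius, beta, if_neg hA, if_pos hB, if_neg this, mul_smul, hmap]
  · have : IsSquare (Matrix.GeneralLinearGroup.det (A * conjGL hK B)) := by
      rw [map_mul]
      exact isSquare_mul_of_not hA (fun h => hB (hdet.1 h))
    simp only [semiMoebius, beta, if_neg hA, if_neg hB, if_pos this, mul_smul, hmap, hinv]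

open scoped Classical in
theorem semiMoebius_infty (hK : Nat.card K = (p ^ m) ^ 2) (A : GL (Fin 2) K) :
    semiMoebius hK A ∞ = A • (∞ : OnePoint K) := by
  unfold semiMoebius beta
  split_ifs <;> rfl

open scoped Classical in
theorem semiMoebius_coe (hK : Nat.card K = (p ^ m) ^ 2) (A : GL (Fin 2) K) (x : K) :
    semiMoebius hK A x = A • ((if IsSquare (Matrix.GeneralLinearGroup.det A) then x
      else x ^ p ^ m : K) : OnePoint K) := by
  unfold semiMoebius beta
  split_ifs
  · rfl
  · rw [OnePoint.map_some, conj_apply]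

open scoped Classical in
theorem scalar_smul (u : Kˣ) (ω : OnePoint K) :
    Matrix.GeneralLinearGroup.scalar (Fin 2) u • ω = ω := by
  cases ω with
  | infty => rw [OnePoint.smul_infty_eq_self_iff]; simp
  | coe x => rw [OnePoint.smul_some_eq_ite]; simp

/-- A scalar matrix `u` has determinant `u²`, so it changes neither the choice of `β` nor the Möbius
action. -/
theorem semiMoebius_mul_scalar (hK : Nat.card K = (p ^ m) ^ 2) (A : GL (Fin 2) K) (u : Kˣ)
    (ω : OnePoint K) :
    semiMoebius hK (A * Matrix.GeneralLinearGroup.scalar (Fin 2) u) ω = semiMoebius hK A ω := by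
  classical
  have h1 : Matrix.GeneralLinearGroup.det (Matrix.GeneralLinearGroup.scalar (Fin 2) u) = u * u := by
    ext
    simp [sq]
  have h2 : IsSquare (Matrix.GeneralLinearGroup.det
      (A * Matrix.GeneralLinearGroup.scalar (Fin 2) u)) ↔
      IsSquare (Matrix.GeneralLinearGroup.det A) := by
    rw [map_mul, h1]
    have hu : IsSquare (u * u) := ⟨u, rfl⟩
    exact ⟨fun h => by simpa only [mul_inv_cancel_right] using h.mul hu.inv, fun h => h.mul hu⟩
  simp only [semiMoebius, beta, h2, mul_smul, scalar_smul]

theorem semiPerm_eq_of_mk_eq (hK : Nat.card K = (p ^ m) ^ 2) {A B : GL (Fin 2) K}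
    (h : Matrix.ProjGenLinGroup.mk A = Matrix.ProjGenLinGroup.mk B) :
    semiPerm hK A = semiPerm hK B := by
  have h1 : A⁻¹ * B ∈ Subgroup.center (GL (Fin 2) K) := by
    rw [← Matrix.ProjGenLinGroup.mk_eq_one, map_mul, map_inv, h, inv_mul_cancel]
  rw [Matrix.GeneralLinearGroup.center_eq_range_scalar] at h1
  obtain ⟨u, hu⟩ := h1
  have h2 : B = A * Matrix.GeneralLinearGroup.scalar (Fin 2) u := by rw [hu, mul_inv_cancel_left]
  ext1 ω
  rw [semiPerm_apply, semiPerm_apply, h2, semiMoebius_mul_scalar]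

/-- Either choice of `β` fixes `∞`, `0` and `1`, so the linear argument applies unchanged: the three
points give `c = 0`, `b = 0` and `a = d` in turn. -/
theorem exists_scalar_of_fixes (hK : Nat.card K = (p ^ m) ^ 2) {A : GL (Fin 2) K}
    (h : semiPerm hK A ∞ = ∞) (h0 : semiPerm hK A (0 : K) = (0 : K))
    (h1 : semiPerm hK A (1 : K) = (1 : K)) :
    ∃ u, A = Matrix.GeneralLinearGroup.scalar (Fin 2) u := by
  classical
  have hpm : p ^ m ≠ 0 := pow_ne_zero _ hp.out.ne_zero
  rw [semiPerm_apply, semiMoebius_infty, OnePoint.smul_infty_eq_self_iff] at h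
  have hdet := A.det_ne_zero
  rw [Matrix.det_fin_two, h, mul_zero, sub_zero] at hdet
  have h00 : A 0 0 ≠ 0 := left_ne_zero_of_mul hdet
  have h11 : A 1 1 ≠ 0 := right_ne_zero_of_mul hdet
  rw [semiPerm_apply, semiMoebius_coe, OnePoint.smul_some_eq_ite] at h0 h1
  have e0 : A 0 1 = 0 := by simpa [h, h11, zero_pow hpm] using h0
  have e1 : A 0 0 = A 1 1 := by simpa [h, h11, e0, div_eq_one_iff_eq] using h1
  refine ⟨Units.mk0 _ h00, ?_⟩
  ext i j
  fin_cases i <;> fin_cases j <;> simp [h, e0, e1]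

theorem semiPerm_one (hK : Nat.card K = (p ^ m) ^ 2) : semiPerm hK 1 = 1 :=
  Equiv.ext (semiMoebius_one hK)

theorem eq_one_of_mem_M_of_fixes (hK : Nat.card K = (p ^ m) ^ 2) {g : Equiv.Perm (OnePoint K)}
    (hg : g ∈ M hK) (h : g ∞ = ∞) (h0 : g (0 : K) = (0 : K)) (h1 : g (1 : K) = (1 : K)) :
    g = 1 := by
  obtain ⟨A, rfl⟩ := (mem_M_iff hK).1 hg
  obtain ⟨u, rfl⟩ := exists_scalar_of_fixes hK h h0 h1
  rw [← semiPerm_one hK]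
  exact semiPerm_eq_of_mk_eq hK (by rw [Matrix.ProjGenLinGroup.mk_scalar, map_one])

/-! ### The deformation of `PGL₂(K)` is `M(q²)` -/

theorem exists_deformation_mulEquiv_M (hK : Nat.card K = (p ^ m) ^ 2) :
    ∃ Φ : Deformation (phiBar hK) ≃* M hK, ∀ A : GL (Fin 2) K,
      (Φ (Deformation.of (phiBar hK) (Matrix.ProjGenLinGroup.mk A)) : Equiv.Perm (OnePoint K))
        = semiPerm hK A := by
  classical
  have hsurj := Matrix.ProjGenLinGroup.mk_surjective (n := Fin 2) (R := K)
  -- An arbitrary matrix representative is chosen; the result does not depend on it by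
  -- `semiPerm_eq_of_mk_eq`.
  let F : Deformation (phiBar hK) → M hK := fun x =>
    ⟨semiPerm hK (Function.surjInv hsurj x.val), semiPerm_mem_M hK _⟩
  have hF : ∀ A : GL (Fin 2) K, (F (Deformation.of (phiBar hK) (Matrix.ProjGenLinGroup.mk A)) :
      Equiv.Perm (OnePoint K)) = semiPerm hK A := fun A =>
    semiPerm_eq_of_mk_eq hK (Function.surjInv_eq hsurj _)
  have hmul : ∀ x y, F (x * y) = F x * F y := by
    rintro ⟨x⟩ ⟨y⟩
    obtain ⟨A, rfl⟩ := hsurj x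
    obtain ⟨B, rfl⟩ := hsurj y
    refine Subtype.ext ?_
    rw [Subgroup.coe_mul, hF, hF, semiPerm_mul, Deformation.of_mul_of, phiBar_mk, ← hF, map_mul]
    have h3 : (conjPGL hK)⁻¹ = conjPGL hK := inv_eq_of_mul_eq_one_left (conjPGL_mul_self hK)
    split_ifs with h
    · rw [inv_one, MulAut.one_apply]
    · rw [h3, conjPGL_mk]
  have hinj : Function.Injective (MonoidHom.mk' F hmul) := by
    rw [injective_iff_map_eq_one]
    rintro ⟨x⟩ hx
    obtain ⟨A, rfl⟩ := hsurj x
    have hA : semiPerm hK A = 1 := by rw [← hF]; exact congrArg Subtype.val hx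
    obtain ⟨u, rfl⟩ := exists_scalar_of_fixes hK (A := A) (by rw [hA]; rfl) (by rw [hA]; rfl)
      (by rw [hA]; rfl)
    rw [Matrix.ProjGenLinGroup.mk_scalar]
    rfl
  refine ⟨MulEquiv.ofBijective (MonoidHom.mk' F hmul) ⟨hinj, ?_⟩, hF⟩
  rintro ⟨g, hg⟩
  obtain ⟨A, rfl⟩ := (mem_M_iff hK).1 hg
  exact ⟨Deformation.of _ (Matrix.ProjGenLinGroup.mk A), Subtype.ext (hF A)⟩

/-! ### The standard transformations -/

open scoped Classical in
theorem semiPerm_matR_infty (hK : Nat.card K = (p ^ m) ^ 2) (u : Kˣ) :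
    semiPerm hK (matR u) ∞ = ∞ := by
  rw [semiPerm_apply, semiMoebius_infty, OnePoint.smul_infty_eq_self_iff]
  rfl

theorem det_matR (u : Kˣ) : Matrix.GeneralLinearGroup.det (matR u) = u := by
  ext
  simp [matR, Matrix.GeneralLinearGroup.mkOfDetNeZero]

open scoped Classical in
theorem semiPerm_matR_coe (hK : Nat.card K = (p ^ m) ^ 2) (u : Kˣ) (x : K) :
    semiPerm hK (matR u) x = (u * if IsSquare u then x else x ^ p ^ m : K) := by
  have h00 : (matR u) 0 0 = (u : K) := rfl
  have h01 : (matR u) 0 1 = 0 := rfl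
  have h10 : (matR u) 1 0 = 0 := rfl
  have h11 : (matR u) 1 1 = 1 := rfl
  rw [semiPerm_apply, semiMoebius_coe, OnePoint.smul_some_eq_ite, det_matR, h00, h01, h10, h11]
  simp

/-- In a field of order `q²`, `-1` is a square. -/
theorem isSquare_neg_one_of_card (hK : Nat.card K = (p ^ m) ^ 2) : IsSquare (-1 : Kˣ) := by
  have := finite_of_card hK
  let _ := Fintype.ofFinite K
  have h : IsSquare (-1 : K) := by
    rw [FiniteField.isSquare_neg_one_iff, ← Nat.card_eq_fintype_card, hK]
    intro h
    have h4 := Nat.pow_mod (p ^ m) 2 4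
    have : p ^ m % 4 < 4 := Nat.mod_lt _ (by norm_num)
    -- `-1` is a square unless the order of the field is `3` modulo `4`, and a perfect square never
    -- is. Hence `T` and `J`, of determinant `-1`, act without the twist.
    interval_cases p ^ m % 4 <;> omega
  obtain ⟨r, hr⟩ := h
  have hr0 : r ≠ 0 := by rintro rfl; simp at hr
  exact ⟨Units.mk0 r hr0, by ext; simpa using hr⟩

theorem det_matT : Matrix.GeneralLinearGroup.det (matT K) = -1 := by
  ext
  simp [matT, Matrix.GeneralLinearGroup.mkOfDetNeZero]

theorem det_matJ : Matrix.GeneralLinearGroup.det (matJ K) = -1 := by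
  ext
  simp [matJ, Matrix.GeneralLinearGroup.mkOfDetNeZero]

theorem semiPerm_matT_infty (hK : Nat.card K = (p ^ m) ^ 2) : semiPerm hK (matT K) ∞ = ∞ := by
  classical
  rw [semiPerm_apply, semiMoebius_infty, OnePoint.smul_infty_eq_self_iff]
  rfl

theorem semiPerm_matT_coe (hK : Nat.card K = (p ^ m) ^ 2) (x : K) :
    semiPerm hK (matT K) x = (1 - x : K) := by
  classical
  have h00 : (matT K) 0 0 = 1 := rfl
  have h01 : (matT K) 0 1 = -1 := rfl
  have h10 : (matT K) 1 0 = 0 := rfl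
  have h11 : (matT K) 1 1 = -1 := rfl
  rw [semiPerm_apply, semiMoebius_coe, OnePoint.smul_some_eq_ite, det_matT,
    if_pos (isSquare_neg_one_of_card hK), h00, h01, h10, h11]
  simp [div_neg, sub_eq_add_neg, add_comm]

theorem semiPerm_matJ_infty (hK : Nat.card K = (p ^ m) ^ 2) :
    semiPerm hK (matJ K) ∞ = (0 : K) := by
  classical
  have h00 : (matJ K) 0 0 = 0 := rfl
  have h10 : (matJ K) 1 0 = -1 := rfl
  rw [semiPerm_apply, semiMoebius_infty, OnePoint.smul_infty_eq_ite, h00, h10]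
  simp

theorem semiPerm_matJ_zero (hK : Nat.card K = (p ^ m) ^ 2) :
    semiPerm hK (matJ K) (0 : K) = ∞ := by
  classical
  have h10 : (matJ K) 1 0 = -1 := rfl
  have h11 : (matJ K) 1 1 = 0 := rfl
  rw [semiPerm_apply, semiMoebius_coe, OnePoint.smul_some_eq_ite, det_matJ,
    if_pos (isSquare_neg_one_of_card hK), h10, h11]
  simp

theorem semiPerm_matJ_coe (hK : Nat.card K = (p ^ m) ^ 2) {x : K} (hx : x ≠ 0) :
    semiPerm hK (matJ K) x = (x⁻¹ : K) := by
  classical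
  have h00 : (matJ K) 0 0 = 0 := rfl
  have h01 : (matJ K) 0 1 = -1 := rfl
  have h10 : (matJ K) 1 0 = -1 := rfl
  have h11 : (matJ K) 1 1 = 0 := rfl
  rw [semiPerm_apply, semiMoebius_coe, OnePoint.smul_some_eq_ite, det_matJ,
    if_pos (isSquare_neg_one_of_card hK), h00, h01, h10, h11]
  simp [hx, neg_div]

/-! ### Sharp `3`-transitivity -/

theorem semiPerm_matR_zero (hK : Nat.card K = (p ^ m) ^ 2) (u : Kˣ) :
    semiPerm hK (matR u) (0 : K) = (0 : K) := by
  have hpm : p ^ m ≠ 0 := pow_ne_zero _ hp.out.ne_zero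
  rw [semiPerm_matR_coe, zero_pow hpm, ite_self, mul_zero]

/-- Take `u = x⁻¹` for a square `x` and `u = (x ^ q)⁻¹` otherwise. In the second case `u` is again a
non-square, since `x = (x ^ q) ^ q`, so the twist is present and the product is `1`. -/
theorem exists_semiPerm_matR_eq_one (hK : Nat.card K = (p ^ m) ^ 2) {x : K} (hx : x ≠ 0) :
    ∃ u, semiPerm hK (matR u) x = (1 : K) := by
  lift x to Kˣ using hx.isUnit
  by_cases h : IsSquare x
  · exact ⟨x⁻¹, by rw [semiPerm_matR_coe, if_pos h.inv, Units.inv_mul]⟩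
  · refine ⟨(x ^ p ^ m)⁻¹, ?_⟩
    by_cases h' : IsSquare (x ^ p ^ m)⁻¹
    · exfalso
      have h2 : IsSquare (x ^ p ^ m) := by simpa using h'.inv
      have h3 : IsSquare ((x ^ p ^ m) ^ p ^ m) := h2.pow _
      have h4 : (x ^ p ^ m) ^ p ^ m = x := by
        ext
        have := conj_conj hK (x : K)
        rw [conj_apply, conj_apply] at this
        simpa using this
      exact h (h4 ▸ h3)
    · rw [semiPerm_matR_coe, if_neg h', ← Units.val_pow_eq_pow_val, Units.inv_mul]

/-- A permutation group containing the standard transformations is `3`-transitive. -/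
theorem exists_mem_map_to_standard (hK : Nat.card K = (p ^ m) ^ 2)
    {N : Subgroup (Equiv.Perm (OnePoint K))} (hR : ∀ u, semiPerm hK (matR u) ∈ N)
    (hT : semiPerm hK (matT K) ∈ N) (hJ : semiPerm hK (matJ K) ∈ N) {x y z : OnePoint K}
    (hxy : x ≠ y) (hxz : x ≠ z) (hyz : y ≠ z) :
    ∃ g ∈ N, g x = ∞ ∧ g y = (0 : K) ∧ g z = (1 : K) := by
  -- A nonzero `y` is scaled to `1` and then sent to `0` by `T`, which takes the place of a
  -- translation.
  have key : ∀ y : K, ∃ g ∈ N, g ∞ = ∞ ∧ g y = (0 : K) := by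
    intro y
    by_cases hy : y = 0
    · exact ⟨1, N.one_mem, rfl, by rw [hy]; rfl⟩
    · obtain ⟨u, hu⟩ := exists_semiPerm_matR_eq_one hK hy
      refine ⟨_, N.mul_mem hT (hR u), ?_, ?_⟩ <;> rw [Equiv.Perm.mul_apply]
      · rw [semiPerm_matR_infty, semiPerm_matT_infty]
      · rw [hu, semiPerm_matT_coe, sub_self]
  have h1 : ∃ g ∈ N, g x = ∞ := by
    cases x with
    | infty => exact ⟨1, N.one_mem, rfl⟩
    | coe x =>
      obtain ⟨g, hg, -, h0⟩ := key x
      exact ⟨_, N.mul_mem hJ hg, by rw [Equiv.Perm.mul_apply, h0, semiPerm_matJ_zero]⟩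
  obtain ⟨g, hg, hgx⟩ := h1
  have h2 : ∃ y' : K, g y = y' := by
    obtain ⟨y', h⟩ := OnePoint.ne_infty_iff_exists.1
      fun h : g y = ∞ => hxy (g.injective (hgx.trans h.symm))
    exact ⟨y', h.symm⟩
  obtain ⟨y', hy'⟩ := h2
  obtain ⟨k, hk, hki, hk0⟩ := key y'
  have h3 : ∃ z' : K, z' ≠ 0 ∧ k (g z) = z' := by
    obtain ⟨z', h⟩ := OnePoint.ne_infty_iff_exists.1
      fun h : k (g z) = ∞ => hxz (g.injective (k.injective (by rw [hgx, hki, h])))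
    refine ⟨z', ?_, h.symm⟩
    rintro rfl
    exact hyz (g.injective (k.injective (by rw [hy', hk0, h])))
  obtain ⟨z', hz0, hz'⟩ := h3
  obtain ⟨u, hu⟩ := exists_semiPerm_matR_eq_one hK hz0
  refine ⟨_, N.mul_mem (hR u) (N.mul_mem hk hg), ?_, ?_, ?_⟩ <;>
    simp only [Equiv.Perm.mul_apply]
  · rw [hgx, hki, semiPerm_matR_infty]
  · rw [hy', hk0, semiPerm_matR_zero]
  · rw [hz', hu]

theorem isSharplyThreeTransitive_M (hK : Nat.card K = (p ^ m) ^ 2) :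
    IsSharplyThreeTransitive (M hK) := by
  have key : ∀ x : Fin 3 → OnePoint K, Function.Injective x →
      ∃ g ∈ M hK, g (x 0) = ∞ ∧ g (x 1) = (0 : K) ∧ g (x 2) = (1 : K) := fun x hx =>
    exists_mem_map_to_standard hK (fun _ => semiPerm_mem_M hK _) (semiPerm_mem_M hK _)
      (semiPerm_mem_M hK _) (hx.ne (by decide)) (hx.ne (by decide)) (hx.ne (by decide))
  intro x y hx hy
  obtain ⟨g, hg, hg0, hg1, hg2⟩ := key x hx
  obtain ⟨k, hk, hk0, hk1, hk2⟩ := key y hy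
  refine ⟨k⁻¹ * g, ⟨mul_mem (inv_mem hk) hg, ?_⟩, ?_⟩
  · intro i
    rw [Equiv.Perm.mul_apply, Equiv.Perm.inv_eq_iff_eq]
    fin_cases i
    · exact hg0.trans hk0.symm
    · exact hg1.trans hk1.symm
    · exact hg2.trans hk2.symm
  · rintro f ⟨hf, hfx⟩
    -- `g` and `k` carry the triples `x` and `y` to `(∞, 0, 1)`, so this product fixes all three
    -- standard points.
    have h1 : k * f * g⁻¹ = 1 := by
      have e0 : g⁻¹ ∞ = x 0 := Equiv.Perm.inv_eq_iff_eq.2 hg0.symm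
      have e1 : g⁻¹ (0 : K) = x 1 := Equiv.Perm.inv_eq_iff_eq.2 hg1.symm
      have e2 : g⁻¹ (1 : K) = x 2 := Equiv.Perm.inv_eq_iff_eq.2 hg2.symm
      refine eq_one_of_mem_M_of_fixes hK (mul_mem (mul_mem hk hf) (inv_mem hg)) ?_ ?_ ?_ <;>
        simp only [Equiv.Perm.mul_apply]
      · rw [e0, hfx, hk0]
      · rw [e1, hfx, hk1]
      · rw [e2, hfx, hk2]
    rw [mul_inv_eq_one] at h1
    rw [← h1, inv_mul_cancel_left]

/-- A subgroup of `M(q²)` containing the standard transformations is all of `M(q²)`. -/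
theorem eq_M_of_standard_mem (hK : Nat.card K = (p ^ m) ^ 2)
    {N : Subgroup (Equiv.Perm (OnePoint K))} (hN : N ≤ M hK) (hR : ∀ u, semiPerm hK (matR u) ∈ N)
    (hT : semiPerm hK (matT K) ∈ N) (hJ : semiPerm hK (matJ K) ∈ N) : N = M hK := by
  refine le_antisymm hN fun g hg => ?_
  -- Choose `k` in `N` returning the images of `∞`, `0`, `1` under `g` to their places; then `k g =
  -- 1` and `g = k⁻¹` lies in `N`.
  obtain ⟨k, hk, h, h0, h1⟩ := exists_mem_map_to_standard hK hR hT hJ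
    (g.injective.ne (OnePoint.infty_ne_coe (0 : K)))
    (g.injective.ne (OnePoint.infty_ne_coe (1 : K)))
    (g.injective.ne fun e => zero_ne_one (OnePoint.coe_injective e))
  have hkg := eq_one_of_mem_M_of_fixes hK (mul_mem (hN hk) hg) h h0 h1
  rw [eq_inv_of_mul_eq_one_right hkg]
  exact inv_mem hk

end Perm

open Gen

section Relators

variable {p m : ℕ} [hp : Fact p.Prime] {K : Type*} [Field K]

/-! ### Powers of the primitive element -/

theorem orderOf_of_generator (hK : Nat.card K = (p ^ m) ^ 2) {ζ : Kˣ}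
    (hζ : ∀ x : Kˣ, x ∈ Subgroup.zpowers ζ) : orderOf ζ = (p ^ m) ^ 2 - 1 := by
  have := finite_of_card hK
  rw [orderOf_eq_card_of_forall_mem_zpowers hζ, Nat.card_units, hK]

theorem natCast_sq_sub_one (h : ℕ) :
    (((2 * h + 1) ^ 2 - 1 : ℕ) : ℤ) = 4 * h * (h + 1) := by
  have : (2 * h + 1) ^ 2 - 1 = 4 * h * (h + 1) := by
    rw [show (2 * h + 1) ^ 2 = 4 * h * (h + 1) + 1 by ring, Nat.add_sub_cancel]
  rw [this]
  push_cast
  ring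

theorem zpow_eq_one_iff_dvd_of_generator (hK : Nat.card K = (p ^ m) ^ 2) {h : ℕ}
    (hq : p ^ m = 2 * h + 1) {ζ : Kˣ} (hζ : ∀ x : Kˣ, x ∈ Subgroup.zpowers ζ) (e : ℤ) :
    ζ ^ e = 1 ↔ 4 * (h : ℤ) * (h + 1) ∣ e := by
  rw [← orderOf_dvd_iff_zpow_eq_one, orderOf_of_generator hK hζ, hq, natCast_sq_sub_one]

/-- The order `q² - 1` of `ζ` is even, so the parity of an exponent is well defined. It therefore
decides whether `R(ζ ^ e)` carries the twist. -/
theorem isSquare_zpow_iff_even (hK : Nat.card K = (p ^ m) ^ 2) {h : ℕ}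
    (hq : p ^ m = 2 * h + 1) {ζ : Kˣ} (hζ : ∀ x : Kˣ, x ∈ Subgroup.zpowers ζ) (e : ℤ) :
    IsSquare (ζ ^ e) ↔ Even e := by
  refine ⟨?_, fun he => he.isSquare_zpow ζ⟩
  rintro ⟨r, hr⟩
  obtain ⟨f, rfl⟩ := Subgroup.mem_zpowers_iff.1 (hζ r)
  have h1 : ζ ^ (e - 2 * f) = 1 := by
    rw [zpow_sub, hr, ← zpow_add, ← two_mul, mul_inv_cancel]
  obtain ⟨n, hn⟩ := (zpow_eq_one_iff_dvd_of_generator hK hq hζ _).1 h1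
  exact ⟨f + 2 * h * (h + 1) * n, by linarith⟩

theorem neg_one_eq_zpow (hK : Nat.card K = (p ^ m) ^ 2) {h : ℕ}
    (hq : p ^ m = 2 * h + 1) (hh : 0 < h) {ζ : Kˣ} (hζ : ∀ x : Kˣ, x ∈ Subgroup.zpowers ζ) :
    ((ζ ^ (2 * (h : ℤ) * (h + 1)) : Kˣ) : K) = -1 := by
  have h1 : (ζ ^ (2 * (h : ℤ) * (h + 1))) ^ 2 = 1 := by
    rw [← zpow_natCast, ← zpow_mul, zpow_eq_one_iff_dvd_of_generator hK hq hζ]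
    exact ⟨1, by push_cast; ring⟩
  have h2 : ζ ^ (2 * (h : ℤ) * (h + 1)) ≠ 1 := by
    rw [Ne, zpow_eq_one_iff_dvd_of_generator hK hq hζ]
    intro hd
    have := Int.le_of_dvd (by positivity) hd
    nlinarith [Int.natCast_pos.2 hh]
  have h3 := congrArg (Units.val : Kˣ → K) h1
  rw [Units.val_pow_eq_pow_val, Units.val_one, sq_eq_one_iff] at h3
  exact h3.resolve_left fun h4 => h2 (Units.ext h4)

/-! ### The torus -/

/-- The transformation attached to `R(ζ ^ e)`. -/
noncomputable def torusPerm (hK : Nat.card K = (p ^ m) ^ 2) (ζ : Kˣ) (e : ℤ) :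
    Equiv.Perm (OnePoint K) := semiPerm hK (matR (ζ ^ e))

theorem torusPerm_infty (hK : Nat.card K = (p ^ m) ^ 2) (ζ : Kˣ) (e : ℤ) :
    torusPerm hK ζ e ∞ = ∞ := semiPerm_matR_infty hK _

theorem torusPerm_even (hK : Nat.card K = (p ^ m) ^ 2) (ζ : Kˣ) {e : ℤ} (he : Even e) (x : K) :
    torusPerm hK ζ e x = (((ζ ^ e : Kˣ) : K) * x : K) := by
  rw [torusPerm, semiPerm_matR_coe, if_pos (he.isSquare_zpow ζ)]

theorem torusPerm_odd (hK : Nat.card K = (p ^ m) ^ 2) {h : ℕ}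
    (hq : p ^ m = 2 * h + 1) {ζ : Kˣ} (hζ : ∀ x : Kˣ, x ∈ Subgroup.zpowers ζ) {e : ℤ}
    (he : ¬ Even e) (x : K) :
    torusPerm hK ζ e x = (((ζ ^ e : Kˣ) : K) * x ^ p ^ m : K) := by
  rw [torusPerm, semiPerm_matR_coe, if_neg ((isSquare_zpow_iff_even hK hq hζ e).not.2 he)]

theorem torusPerm_congr (hK : Nat.card K = (p ^ m) ^ 2) {h : ℕ}
    (hq : p ^ m = 2 * h + 1) {ζ : Kˣ} (hζ : ∀ x : Kˣ, x ∈ Subgroup.zpowers ζ) {e f : ℤ}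
    (hef : 4 * (h : ℤ) * (h + 1) ∣ e - f) : torusPerm hK ζ e = torusPerm hK ζ f := by
  rw [← zpow_eq_one_iff_dvd_of_generator hK hq hζ, zpow_sub, mul_inv_eq_one] at hef
  rw [torusPerm, hef, torusPerm]

theorem torusPerm_of_dvd (hK : Nat.card K = (p ^ m) ^ 2) {h : ℕ}
    (hq : p ^ m = 2 * h + 1) {ζ : Kˣ} (hζ : ∀ x : Kˣ, x ∈ Subgroup.zpowers ζ) {e : ℤ}
    (he : 4 * (h : ℤ) * (h + 1) ∣ e) : torusPerm hK ζ e = 1 := by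
  have h1 : 4 * (h : ℤ) * (h + 1) ∣ e - 0 := by simpa using he
  rw [torusPerm_congr hK hq hζ h1]
  ext1 ω
  cases ω with
  | infty => exact torusPerm_infty hK ζ 0
  | coe x => rw [torusPerm_even hK ζ Even.zero]; simp

theorem torusPerm_mul_even (hK : Nat.card K = (p ^ m) ^ 2) {h : ℕ}
    (hq : p ^ m = 2 * h + 1) {ζ : Kˣ} (hζ : ∀ x : Kˣ, x ∈ Subgroup.zpowers ζ) {e : ℤ}
    (he : Even e) (f : ℤ) : torusPerm hK ζ e * torusPerm hK ζ f = torusPerm hK ζ (e + f) := by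
  ext1 ω
  rw [Equiv.Perm.mul_apply]
  cases ω with
  | infty => simp only [torusPerm_infty]
  | coe x =>
    by_cases hf : Even f
    · rw [torusPerm_even hK ζ hf, torusPerm_even hK ζ he, torusPerm_even hK ζ (he.add hf), zpow_add,
        Units.val_mul, mul_assoc]
    · have hef : ¬ Even (e + f) := by rw [Int.even_add]; tauto
      rw [torusPerm_odd hK hq hζ hf, torusPerm_even hK ζ he, torusPerm_odd hK hq hζ hef, zpow_add,
        Units.val_mul, mul_assoc]

theorem pow_card_pow (hK : Nat.card K = (p ^ m) ^ 2) (x : K) : (x ^ p ^ m) ^ p ^ m = x := by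
  have := conj_conj hK x
  rwa [conj_apply, conj_apply] at this

theorem torusPerm_mul_odd (hK : Nat.card K = (p ^ m) ^ 2) {h : ℕ}
    (hq : p ^ m = 2 * h + 1) {ζ : Kˣ} (hζ : ∀ x : Kˣ, x ∈ Subgroup.zpowers ζ) {e : ℤ}
    (he : ¬ Even e) (f : ℤ) :
    torusPerm hK ζ e * torusPerm hK ζ f = torusPerm hK ζ (e + (p ^ m : ℕ) * f) := by
  have hodd : ¬ Even ((p ^ m : ℕ) : ℤ) := by rw [hq]; simp
  have hz : ((ζ ^ (e + (p ^ m : ℕ) * f) : Kˣ) : K) =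
      ((ζ ^ e : Kˣ) : K) * ((ζ ^ f : Kˣ) : K) ^ p ^ m := by
    rw [zpow_add, Units.val_mul, mul_comm _ f, zpow_mul, zpow_natCast, Units.val_pow_eq_pow_val]
  ext1 ω
  rw [Equiv.Perm.mul_apply]
  cases ω with
  | infty => simp only [torusPerm_infty]
  | coe x =>
    by_cases hf : Even f
    · have hef : ¬ Even (e + (p ^ m : ℕ) * f) := by rw [Int.even_add, Int.even_mul]; tauto
      rw [torusPerm_even hK ζ hf, torusPerm_odd hK hq hζ he, torusPerm_odd hK hq hζ hef, hz,
        mul_pow, mul_assoc]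
    · have hef : Even (e + (p ^ m : ℕ) * f) := by rw [Int.even_add, Int.even_mul]; tauto
      rw [torusPerm_odd hK hq hζ hf, torusPerm_odd hK hq hζ he, torusPerm_even hK ζ hef, hz,
        mul_pow, pow_card_pow hK, mul_assoc]

theorem torusPerm_pow (hK : Nat.card K = (p ^ m) ^ 2) {h : ℕ}
    (hq : p ^ m = 2 * h + 1) {ζ : Kˣ} (hζ : ∀ x : Kˣ, x ∈ Subgroup.zpowers ζ) (n : ℕ) :
    torusPerm hK ζ 2 ^ n = torusPerm hK ζ (2 * n) := by
  induction n with
  | zero => rw [pow_zero, torusPerm_of_dvd hK hq hζ (by simp)]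
  | succ n ih =>
    rw [pow_succ', ih, torusPerm_mul_even hK hq hζ even_two]
    congr 1
    push_cast
    ring

/-! ### The relators act trivially -/

/-- The transformations attached to the three generators. -/
noncomputable def genPerm (hK : Nat.card K = (p ^ m) ^ 2) (ζ : Kˣ) :
    Gen → Equiv.Perm (OnePoint K)
  | Gen.a => semiPerm hK (matR ζ⁻¹)
  | Gen.T => semiPerm hK (matT K)
  | Gen.J => semiPerm hK (matJ K)

theorem genPerm_a (hK : Nat.card K = (p ^ m) ^ 2) (ζ : Kˣ) :
    genPerm hK ζ Gen.a = torusPerm hK ζ (-1) := by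
  rw [genPerm, torusPerm, zpow_neg_one]

theorem lift_wa (hK : Nat.card K = (p ^ m) ^ 2) (ζ : Kˣ) :
    FreeGroup.lift (genPerm hK ζ) wa = torusPerm hK ζ (-1) := by
  rw [wa, FreeGroup.lift_apply_of, genPerm_a]

theorem lift_wT (hK : Nat.card K = (p ^ m) ^ 2) (ζ : Kˣ) :
    FreeGroup.lift (genPerm hK ζ) wT = semiPerm hK (matT K) := by
  rw [wT, FreeGroup.lift_apply_of, genPerm]

theorem lift_wJ (hK : Nat.card K = (p ^ m) ^ 2) (ζ : Kˣ) :
    FreeGroup.lift (genPerm hK ζ) wJ = semiPerm hK (matJ K) := by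
  rw [wJ, FreeGroup.lift_apply_of, genPerm]

theorem semiPerm_matJ_mul_self (hK : Nat.card K = (p ^ m) ^ 2) :
    semiPerm hK (matJ K) * semiPerm hK (matJ K) = 1 := by
  ext1 ω
  rw [Equiv.Perm.mul_apply, Equiv.Perm.one_apply]
  cases ω with
  | infty => rw [semiPerm_matJ_infty, semiPerm_matJ_zero]
  | coe x =>
    by_cases hx : x = 0
    · rw [hx, semiPerm_matJ_zero, semiPerm_matJ_infty]
    · rw [semiPerm_matJ_coe hK hx, semiPerm_matJ_coe hK (inv_ne_zero hx), inv_inv]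

theorem semiPerm_matT_mul_self (hK : Nat.card K = (p ^ m) ^ 2) :
    semiPerm hK (matT K) * semiPerm hK (matT K) = 1 := by
  ext1 ω
  rw [Equiv.Perm.mul_apply, Equiv.Perm.one_apply]
  cases ω with
  | infty => rw [semiPerm_matT_infty, semiPerm_matT_infty]
  | coe x => rw [semiPerm_matT_coe, semiPerm_matT_coe, sub_sub_cancel]

theorem torusPerm_zero (hK : Nat.card K = (p ^ m) ^ 2) (ζ : Kˣ) (e : ℤ) :
    torusPerm hK ζ e (0 : K) = (0 : K) := semiPerm_matR_zero hK _

theorem torusPerm_one (hK : Nat.card K = (p ^ m) ^ 2) (ζ : Kˣ) (e : ℤ) :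
    torusPerm hK ζ e (1 : K) = ((ζ ^ e : Kˣ) : K) := by
  rw [torusPerm, semiPerm_matR_coe, one_pow, ite_self, mul_one]

theorem semiPerm_matJ_conj_torusPerm (hK : Nat.card K = (p ^ m) ^ 2) {h : ℕ}
    (hq : p ^ m = 2 * h + 1) {ζ : Kˣ} (hζ : ∀ x : Kˣ, x ∈ Subgroup.zpowers ζ) (e : ℤ) :
    semiPerm hK (matJ K) * torusPerm hK ζ e * semiPerm hK (matJ K) = torusPerm hK ζ (-e) := by
  ext1 ω
  rw [Equiv.Perm.mul_apply, Equiv.Perm.mul_apply]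
  cases ω with
  | infty => rw [semiPerm_matJ_infty, torusPerm_zero, semiPerm_matJ_zero, torusPerm_infty]
  | coe x =>
    by_cases hx : x = 0
    · rw [hx, semiPerm_matJ_zero, torusPerm_infty, semiPerm_matJ_infty, torusPerm_zero]
    · rw [semiPerm_matJ_coe hK hx]
      by_cases he : Even e
      · rw [torusPerm_even hK ζ he, torusPerm_even hK ζ he.neg, semiPerm_matJ_coe hK
          (mul_ne_zero (Units.ne_zero _) (inv_ne_zero hx))]
        simp [mul_comm]
      · have he' : ¬ Even (-e) := by rwa [even_neg]
        rw [torusPerm_odd hK hq hζ he, torusPerm_odd hK hq hζ he', semiPerm_matJ_coe hK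
          (mul_ne_zero (Units.ne_zero _) (pow_ne_zero _ (inv_ne_zero hx)))]
        simp [mul_comm]

theorem lift_wb (hK : Nat.card K = (p ^ m) ^ 2) {h : ℕ}
    (hq : p ^ m = 2 * h + 1) {ζ : Kˣ} (hζ : ∀ x : Kˣ, x ∈ Subgroup.zpowers ζ) :
    FreeGroup.lift (genPerm hK ζ) wb = torusPerm hK ζ 2 := by
  have hJ : (semiPerm hK (matJ K))⁻¹ = semiPerm hK (matJ K) :=
    inv_eq_of_mul_eq_one_left (semiPerm_matJ_mul_self hK)
  -- `J R(ζ⁻¹) J = R(ζ)`, and `R(ζ) = R(ζ²) R(ζ⁻¹)` because the left factor is untwisted; so `[J,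
  -- a]` acts as `R(ζ²)`.
  rw [wb, map_mul, map_mul, map_mul, map_inv, map_inv, lift_wJ, lift_wa, hJ,
    semiPerm_matJ_conj_torusPerm hK hq hζ, mul_inv_eq_iff_eq_mul, neg_neg,
    torusPerm_mul_even hK hq hζ even_two]
  norm_num

theorem lift_wR (hK : Nat.card K = (p ^ m) ^ 2) {h : ℕ}
    (hq : p ^ m = 2 * h + 1) {ζ : Kˣ} (hζ : ∀ x : Kˣ, x ∈ Subgroup.zpowers ζ) (k : ℕ) :
    FreeGroup.lift (genPerm hK ζ) (wR k) = torusPerm hK ζ k := by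
  rw [wR, map_mul, map_pow, map_pow, lift_wb hK hq hζ, lift_wa, torusPerm_pow hK hq hζ]
  obtain ⟨i, rfl | rfl⟩ := Nat.even_or_odd' k
  · rw [show (2 * i + 1) / 2 = i by omega, show 2 * i - 2 * (2 * i / 2) = 0 by omega, pow_zero,
      mul_one]
    push_cast
    rfl
  · rw [show (2 * i + 1 + 1) / 2 = i + 1 by omega,
      show 2 * i + 1 - 2 * ((2 * i + 1) / 2) = 1 by omega, pow_one,
      torusPerm_mul_even hK hq hζ (even_two_mul _)]
    congr 1
    push_cast
    ring

theorem toNat_emod_sub (h : ℕ) (hh : 0 < h) (e : ℤ) :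
    (((e % (((2 * h + 1 : ℕ) : ℤ) ^ 2 - 1)).toNat : ℕ) : ℤ) = e % (4 * h * (h + 1)) := by
  have h1 : (((2 * h + 1 : ℕ) : ℤ) ^ 2 - 1) = 4 * h * (h + 1) := by push_cast; ring
  rw [h1, Int.toNat_of_nonneg (Int.emod_nonneg _ (by positivity))]

theorem lift_wRζ (hK : Nat.card K = (p ^ m) ^ 2) {h : ℕ}
    (hq : p ^ m = 2 * h + 1) (hh : 0 < h) {ζ : Kˣ} (hζ : ∀ x : Kˣ, x ∈ Subgroup.zpowers ζ)
    (e : ℤ) : FreeGroup.lift (genPerm hK ζ) (wRζ (p ^ m) e) = torusPerm hK ζ e := by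
  rw [wRζ, lift_wR hK hq hζ, hq, toNat_emod_sub h hh]
  refine torusPerm_congr hK hq hζ ?_
  rw [← dvd_neg, neg_sub]
  exact Int.dvd_self_sub_emod

/-- With `β` the twist of `ζ ^ j`, the left side sends `x` to `1 - ζ^j + ζ^j β(x) = ζ^k (1 + ζ^(j-k)
β(x))`. The sign is `ζ ^ ((q²-1)/2)`. Since `(q²-1)/2` and `k` are even, the last exponent has the
parity of `j`, and so the same twist. -/
theorem semiPerm_matT_conj_torusPerm_even (hK : Nat.card K = (p ^ m) ^ 2) {h : ℕ}
    (hq : p ^ m = 2 * h + 1) (hh : 0 < h) {ζ : Kˣ} (hζ : ∀ x : Kˣ, x ∈ Subgroup.zpowers ζ)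
    {j k : ℤ} (hjk : 1 - ((ζ ^ j : Kˣ) : K) = ((ζ ^ k : Kˣ) : K)) (hk : Even k) :
    semiPerm hK (matT K) * torusPerm hK ζ j * semiPerm hK (matT K) =
      torusPerm hK ζ k * semiPerm hK (matT K) *
        torusPerm hK ζ (2 * (h : ℤ) * (h + 1) - k + j) := by
  have hz : ((ζ ^ (2 * (h : ℤ) * (h + 1) - k + j) : Kˣ) : K) =
      - (((ζ ^ k : Kˣ) : K)⁻¹ * ((ζ ^ j : Kˣ) : K)) := by
    rw [zpow_add, zpow_sub, Units.val_mul, Units.val_mul, neg_one_eq_zpow hK hq hh hζ,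
      Units.val_inv_eq_inv_val]
    ring
  have hk0 : ((ζ ^ k : Kˣ) : K) ≠ 0 := Units.ne_zero _
  have he : Even (2 * (h : ℤ) * (h + 1) - k) := by
    rw [mul_assoc]; exact (even_two_mul _).sub hk
  ext1 ω
  simp only [Equiv.Perm.mul_apply]
  cases ω with
  | infty => simp only [torusPerm_infty, semiPerm_matT_infty]
  | coe x =>
    by_cases hj : Even j
    · rw [semiPerm_matT_coe, torusPerm_even hK ζ hj, semiPerm_matT_coe,
        torusPerm_even hK ζ (he.add hj), semiPerm_matT_coe, torusPerm_even hK ζ hk, hz]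
      congr 1
      field_simp
      linear_combination hjk
    · have hj' : ¬ Even (2 * (h : ℤ) * (h + 1) - k + j) := by rw [Int.even_add]; tauto
      have := charP_of_card hK
      rw [semiPerm_matT_coe, torusPerm_odd hK hq hζ hj, semiPerm_matT_coe,
        torusPerm_odd hK hq hζ hj', semiPerm_matT_coe, torusPerm_even hK ζ hk, hz,
        sub_pow_char_pow, one_pow]
      congr 1
      field_simp
      linear_combination hjk

/-- Now `R(ζ^k)` raises what stands inside to the power `q`. The inner coefficient must therefore be
`-(ζ^(j-k))^q`, which that power returns to `-ζ^(j-k)`. Subtracting the odd `q k` flips the parity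
relative to `j`, so the inner and outer twists together give the twist of `ζ ^ j`. -/
theorem semiPerm_matT_conj_torusPerm_odd (hK : Nat.card K = (p ^ m) ^ 2) {h : ℕ}
    (hq : p ^ m = 2 * h + 1) (hh : 0 < h) {ζ : Kˣ} (hζ : ∀ x : Kˣ, x ∈ Subgroup.zpowers ζ)
    {j k : ℤ} (hjk : 1 - ((ζ ^ j : Kˣ) : K) = ((ζ ^ k : Kˣ) : K)) (hk : ¬ Even k) :
    semiPerm hK (matT K) * torusPerm hK ζ j * semiPerm hK (matT K) =
      torusPerm hK ζ k * semiPerm hK (matT K) *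
        torusPerm hK ζ (2 * (h : ℤ) * (h + 1) - (p ^ m : ℕ) * k + (p ^ m : ℕ) * j) := by
  have hodd : ¬ Even ((p ^ m : ℕ) : ℤ) := by rw [hq]; simp
  have hz : ((ζ ^ (2 * (h : ℤ) * (h + 1) - (p ^ m : ℕ) * k + (p ^ m : ℕ) * j) : Kˣ) : K) =
      - ((((ζ ^ k : Kˣ) : K)⁻¹ * ((ζ ^ j : Kˣ) : K)) ^ p ^ m) := by
    rw [zpow_add, zpow_sub, Units.val_mul, Units.val_mul, neg_one_eq_zpow hK hq hh hζ,
      Units.val_inv_eq_inv_val, mul_comm _ k, mul_comm _ j, zpow_mul, zpow_mul, zpow_natCast,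
      zpow_natCast, Units.val_pow_eq_pow_val, Units.val_pow_eq_pow_val, mul_pow, inv_pow]
    ring
  have hk0 : ((ζ ^ k : Kˣ) : K) ≠ 0 := Units.ne_zero _
  have he : ¬ Even (2 * (h : ℤ) * (h + 1) - (p ^ m : ℕ) * k) := by
    rw [mul_assoc, Int.even_sub, Int.even_mul]
    have := even_two_mul ((h : ℤ) * (h + 1))
    simp only [Int.even_mul] at *
    tauto
  have hoddq : Odd (p ^ m) := ⟨h, hq⟩
  have := charP_of_card hK
  have hfrob : ∀ y : K, (1 - - ((((ζ ^ k : Kˣ) : K)⁻¹ * ((ζ ^ j : Kˣ) : K)) ^ p ^ m) * y) ^ p ^ m =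
      1 + ((ζ ^ k : Kˣ) : K)⁻¹ * ((ζ ^ j : Kˣ) : K) * y ^ p ^ m := by
    intro y
    rw [sub_pow_char_pow, one_pow, mul_pow, hoddq.neg_pow, pow_card_pow hK]
    ring
  ext1 ω
  simp only [Equiv.Perm.mul_apply]
  cases ω with
  | infty => simp only [torusPerm_infty, semiPerm_matT_infty]
  | coe x =>
    by_cases hj : Even j
    · have hj' : ¬ Even (2 * (h : ℤ) * (h + 1) - (p ^ m : ℕ) * k + (p ^ m : ℕ) * j) := by
        rw [Int.even_add, Int.even_mul (m := ((p ^ m : ℕ) : ℤ))]; tauto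
      rw [semiPerm_matT_coe, torusPerm_even hK ζ hj, semiPerm_matT_coe,
        torusPerm_odd hK hq hζ hj', semiPerm_matT_coe, torusPerm_odd hK hq hζ hk, hz,
        hfrob, pow_card_pow hK]
      congr 1
      field_simp
      linear_combination hjk
    · have hj' : Even (2 * (h : ℤ) * (h + 1) - (p ^ m : ℕ) * k + (p ^ m : ℕ) * j) := by
        rw [Int.even_add, Int.even_mul (m := ((p ^ m : ℕ) : ℤ))]; tauto
      rw [semiPerm_matT_coe, torusPerm_odd hK hq hζ hj, semiPerm_matT_coe,
        torusPerm_even hK ζ hj', semiPerm_matT_coe, torusPerm_odd hK hq hζ hk, hz,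
        hfrob, sub_pow_char_pow, one_pow]
      congr 1
      field_simp
      linear_combination hjk

theorem semiPerm_matJ_mul_matT_pow_three (hK : Nat.card K = (p ^ m) ^ 2) :
    (semiPerm hK (matJ K) * semiPerm hK (matT K)) ^ 3 = 1 := by
  ext1 ω
  simp only [pow_succ, pow_zero, one_mul, Equiv.Perm.mul_apply, Equiv.Perm.one_apply]
  cases ω with
  | infty =>
    rw [semiPerm_matT_infty, semiPerm_matJ_infty, semiPerm_matT_coe, sub_zero,
      semiPerm_matJ_coe hK one_ne_zero, inv_one, semiPerm_matT_coe, sub_self, semiPerm_matJ_zero]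
  | coe x =>
    by_cases h1 : x = 1
    · rw [h1, semiPerm_matT_coe, sub_self, semiPerm_matJ_zero, semiPerm_matT_infty,
        semiPerm_matJ_infty, semiPerm_matT_coe, sub_zero, semiPerm_matJ_coe hK one_ne_zero, inv_one]
    have h1' : 1 - x ≠ 0 := sub_ne_zero.2 (Ne.symm h1)
    by_cases h0 : x = 0
    · rw [h0, semiPerm_matT_coe, sub_zero, semiPerm_matJ_coe hK one_ne_zero, inv_one,
        semiPerm_matT_coe, sub_self, semiPerm_matJ_zero, semiPerm_matT_infty, semiPerm_matJ_infty]
    have h2 : 1 - (1 - x)⁻¹ = - x / (1 - x) := by field_simp; ring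
    have h3 : - x / (1 - x) ≠ 0 := div_ne_zero (neg_ne_zero.2 h0) h1'
    have h4 : 1 - (- x / (1 - x))⁻¹ = x⁻¹ := by field_simp; ring
    rw [semiPerm_matT_coe, semiPerm_matJ_coe hK h1', semiPerm_matT_coe, h2,
      semiPerm_matJ_coe hK h3, semiPerm_matT_coe, h4, semiPerm_matJ_coe hK (inv_ne_zero h0),
      inv_inv]

theorem lift_relator (hK : Nat.card K = (p ^ m) ^ 2) {h : ℕ}
    (hq : p ^ m = 2 * h + 1) (hh : 0 < h) {ζ : Kˣ} (hζ : ∀ x : Kˣ, x ∈ Subgroup.zpowers ζ)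
    {r : FreeGroup Gen} (hr : r ∈ relators (p ^ m) ζ) :
    FreeGroup.lift (genPerm hK ζ) r = 1 := by
  have hqz : (((p ^ m : ℕ) : ℤ) ^ 2 - 1) / 2 = 2 * (h : ℤ) * (h + 1) := by
    rw [hq, show (((2 * h + 1 : ℕ) : ℤ) ^ 2 - 1) = 2 * (2 * h * (h + 1)) by push_cast; ring,
      Int.mul_ediv_cancel_left _ two_ne_zero]
  have hqn : ((p ^ m) ^ 2 - 1) / 2 = 2 * h * (h + 1) := by
    rw [hq, show (2 * h + 1) ^ 2 = 2 * (2 * h * (h + 1)) + 1 by ring]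
    omega
  have hqh : (p ^ m + 1) / 2 = h + 1 := by omega
  have hq1 : p ^ m - 1 = 2 * h := by omega
  have hneg : ¬ Even (-1 : ℤ) := by decide
  rcases hr with ((rfl | rfl | rfl | rfl | rfl | rfl | rfl) | hr) | hr
  · rw [map_pow, lift_wb hK hq hζ, torusPerm_pow hK hq hζ, hqn]
    exact torusPerm_of_dvd hK hq hζ ⟨1, by push_cast; ring⟩
  · rw [map_mul, map_pow, map_inv, map_pow, map_inv, lift_wb hK hq hζ, lift_wa, inv_pow, inv_inv,
      torusPerm_pow hK hq hζ, sq, torusPerm_mul_odd hK hq hζ hneg, hqh, torusPerm_mul_even hK hq hζ]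
    -- The total exponent vanishes: `a²` contributes `-1 - q` and the power of `[J, a]` contributes
    -- `q + 1`.
    · exact torusPerm_of_dvd hK hq hζ ⟨0, by rw [hq]; push_cast; ring⟩
    · rw [hq]; exact ⟨-(h + 1), by push_cast; ring⟩
  · rw [map_mul, map_mul, map_mul, map_inv, map_inv, map_mul, map_pow, lift_wb hK hq hζ, lift_wa,
      mul_inv_eq_one, mul_assoc, inv_mul_eq_iff_eq_mul, ← mul_assoc, ← pow_succ',
      torusPerm_mul_odd hK hq hζ hneg, torusPerm_pow hK hq hζ,
      torusPerm_mul_even hK hq hζ (even_two_mul _), hq1, hq]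
    congr 1
    push_cast
    ring
  · rw [map_pow, lift_wT, sq, semiPerm_matT_mul_self]
  · rw [map_pow, lift_wJ, sq, semiPerm_matJ_mul_self]
  · rw [map_pow, map_mul, lift_wJ, lift_wb hK hq hζ, sq, ← mul_assoc,
      semiPerm_matJ_conj_torusPerm hK hq hζ, torusPerm_mul_even hK hq hζ (by decide)]
    exact torusPerm_of_dvd hK hq hζ ⟨0, by ring⟩
  · rw [map_pow, map_mul, lift_wJ, lift_wT, semiPerm_matJ_mul_matT_pow_three]
  · obtain ⟨j, k, -, -, -, -, hjk, hk, rfl⟩ := hr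
    simp only [map_mul, map_inv, lift_wT, lift_wRζ hK hq hh hζ]
    rw [mul_inv_eq_one, hqz]
    exact semiPerm_matT_conj_torusPerm_even hK hq hh hζ (by simpa using hjk) (by simpa using hk)
  · obtain ⟨j, k, -, -, -, -, hjk, hk, rfl⟩ := hr
    simp only [map_mul, map_inv, lift_wT, lift_wRζ hK hq hh hζ]
    rw [mul_inv_eq_one, hqz]
    exact semiPerm_matT_conj_torusPerm_odd hK hq hh hζ (by simpa using hjk) (by simpa using hk)

end Relators

/-! ### The presented group and its faithful action -/

section Presentation

variable {p m : ℕ} [hp : Fact p.Prime] {K : Type*} [Field K]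

theorem mk_wR (rels : Set (FreeGroup Gen)) (k : ℕ) :
    PresentedGroup.mk rels (wR k) =
      torusElt (PresentedGroup.mk rels wb) (PresentedGroup.mk rels wa) k := by
  have h1 : (((k + 1) / 2 : ℕ) : ℤ) = ((k : ℤ) + 1) / 2 := by omega
  have h2 : ((k - 2 * (k / 2) : ℕ) : ℤ) = (k : ℤ) % 2 := by omega
  rw [wR, map_mul, map_pow, map_pow, torusElt, ← h1, ← h2, zpow_natCast, zpow_natCast]

/-- The images in the presented group of `[J, a]` and the generators satisfy the relations from
which the normal forms are derived. -/
theorem zRelations_presentedGroup (hK : Nat.card K = (p ^ m) ^ 2) {h : ℕ}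
    (hq : p ^ m = 2 * h + 1) (hh : 0 < h) {ζ : Kˣ} (hζ : ∀ x : Kˣ, x ∈ Subgroup.zpowers ζ) :
    ZRelations (h : ℤ) (PresentedGroup.mk (relators (p ^ m) ζ) wb)
      (PresentedGroup.mk (relators (p ^ m) ζ) wa) (PresentedGroup.mk (relators (p ^ m) ζ) wT)
      (PresentedGroup.mk (relators (p ^ m) ζ) wJ) := by
  have hone : ∀ {x}, x ∈ relators (p ^ m) ζ → PresentedGroup.mk (relators (p ^ m) ζ) x = 1 :=
    fun hx => PresentedGroup.one_of_mem hx
  have hqn : ((p ^ m) ^ 2 - 1) / 2 = 2 * h * (h + 1) := by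
    rw [hq, show (2 * h + 1) ^ 2 = 2 * (2 * h * (h + 1)) + 1 by ring]
    omega
  have hqh : (p ^ m + 1) / 2 = h + 1 := by omega
  have hq1 : p ^ m - 1 = 2 * h := by omega
  have hJ : PresentedGroup.mk (relators (p ^ m) ζ) wJ * PresentedGroup.mk (relators (p ^ m) ζ) wJ
      = 1 := by
    rw [← map_mul, ← sq]
    exact hone (by simp [relators])
  have hT : PresentedGroup.mk (relators (p ^ m) ζ) wT * PresentedGroup.mk (relators (p ^ m) ζ) wT
      = 1 := by
    rw [← map_mul, ← sq]
    exact hone (by simp [relators])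
  have h1 : PresentedGroup.mk (relators (p ^ m) ζ) (wb ^ (((p ^ m) ^ 2 - 1) / 2)) = 1 :=
    hone (by simp [relators])
  have h2 : PresentedGroup.mk (relators (p ^ m) ζ) (wa ^ 2 * (wb⁻¹ ^ ((p ^ m + 1) / 2))⁻¹) = 1 :=
    hone (by simp [relators])
  have h3 : PresentedGroup.mk (relators (p ^ m) ζ) ((wb⁻¹ * wa * wb) * (wb ^ (p ^ m - 1) * wa)⁻¹)
      = 1 := hone (by simp [relators])
  have h4 : PresentedGroup.mk (relators (p ^ m) ζ) ((wJ * wb) ^ 2) = 1 := hone (by simp [relators])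
  have h5 : PresentedGroup.mk (relators (p ^ m) ζ) ((wJ * wT) ^ 3) = 1 := hone (by simp [relators])
  have h6 : PresentedGroup.mk (relators (p ^ m) ζ) wb = PresentedGroup.mk (relators (p ^ m) ζ) wJ *
      PresentedGroup.mk (relators (p ^ m) ζ) wa * (PresentedGroup.mk (relators (p ^ m) ζ) wJ)⁻¹ *
      (PresentedGroup.mk (relators (p ^ m) ζ) wa)⁻¹ := by
    rw [wb, map_mul, map_mul, map_mul, map_inv, map_inv]
  have hwR := mk_wR (relators (p ^ m) ζ)
  -- The even and odd families differ only in the last exponent, whose value is irrelevant for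
  -- normal forms.
  have h7 : ∀ j k : ℕ, 1 ≤ j → j < (p ^ m) ^ 2 - 1 → 1 ≤ k → k < (p ^ m) ^ 2 - 1 →
      1 - (ζ : K) ^ j = (ζ : K) ^ k → ∃ f : ℤ, PresentedGroup.mk (relators (p ^ m) ζ)
        ((wT * wRζ (p ^ m) j * wT) * (wRζ (p ^ m) k * wT * wRζ (p ^ m) f)⁻¹) = 1 := by
    intro j k hj hj' hk hk' hjk
    by_cases hke : Even k
    · exact ⟨_, hone (Or.inl (Or.inr ⟨j, k, hj, hj', hk, hk', hjk, hke, rfl⟩))⟩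
    · exact ⟨_, hone (Or.inr ⟨j, k, hj, hj', hk, hk', hjk, hke, rfl⟩)⟩
  have hmod : (((p ^ m : ℕ) : ℤ) ^ 2 - 1) = 4 * h * (h + 1) := by rw [hq]; push_cast; ring
  have hpos : (0 : ℤ) < 4 * h * (h + 1) := by positivity
  have hcast : (((p ^ m) ^ 2 - 1 : ℕ) : ℤ) = 4 * h * (h + 1) := by rw [hq, natCast_sq_sub_one]
  generalize PresentedGroup.mk (relators (p ^ m) ζ) = π at *
  have hJ' : (π wJ)⁻¹ = π wJ := inv_eq_of_mul_eq_one_left hJ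
  have hT' : (π wT)⁻¹ = π wT := inv_eq_of_mul_eq_one_left hT
  refine ⟨?_, ?_, ?_, hT, hJ, ?_, ?_, ?_, ?_⟩
  · rw [map_pow, hqn] at h1
    exact_mod_cast h1
  · rw [map_mul, map_inv, map_pow, map_pow, map_inv, hqh, mul_inv_eq_one, sq, inv_pow] at h2
    rw [h2, zpow_neg]
    norm_cast
  · rw [map_mul, map_inv, map_mul, map_mul, map_mul, map_inv, map_pow, hq1, mul_inv_eq_one,
      mul_assoc, inv_mul_eq_iff_eq_mul, ← mul_assoc, ← pow_succ'] at h3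
    rw [h3]
    norm_cast
  · rw [map_pow, map_mul, sq, ← mul_assoc] at h4
    exact eq_inv_of_mul_eq_one_left h4
  · rw [h6, hJ', inv_mul_cancel_right]
  · rw [map_pow, map_mul] at h5
    -- `(JT)³` splits as `(JTJ)(TJT)`, and `TJT` is its own inverse.
    have h8 : (π wJ * π wT * π wJ) * (π wT * π wJ * π wT) = 1 := by
      rw [← h5]; simp only [pow_succ, pow_zero, one_mul, mul_assoc]
    rw [eq_inv_of_mul_eq_one_left h8, mul_inv_rev, mul_inv_rev, hJ', hT', mul_assoc]
  · intro n hn0 hlt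
    lift n to ℕ using hn0.le
    have hζn : ζ ^ n ≠ 1 := by
      intro h8
      rw [← zpow_natCast, zpow_eq_one_iff_dvd_of_generator hK hq hζ] at h8
      exact hlt.not_ge (Int.le_of_dvd (by omega) h8)
    have hu : 1 - (ζ : K) ^ n ≠ 0 := by
      rw [sub_ne_zero]
      intro h8
      exact hζn (Units.ext (by simpa using h8.symm))
    -- The index `k_n` is the discrete logarithm of `1 - ζ^n`, reduced modulo `q² - 1`; the residue
    -- `0` is ruled out below, since it would force `ζ^n = 0`.
    obtain ⟨l, hl⟩ := Subgroup.mem_zpowers_iff.1 (hζ (Units.mk0 _ hu))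
    have hlk := Int.emod_lt_of_pos l hpos
    have hlnn := Int.emod_nonneg l hpos.ne'
    have hl2 : ζ ^ (l % (4 * h * (h + 1))) = Units.mk0 _ hu := by
      rw [← hl]
      refine mul_inv_eq_one.1 ?_
      rw [← zpow_sub, zpow_eq_one_iff_dvd_of_generator hK hq hζ, ← dvd_neg, neg_sub]
      exact Int.dvd_self_sub_emod
    generalize l % (4 * (h : ℤ) * (h + 1)) = k at *
    lift k to ℕ using hlnn
    have hk : 1 - (ζ : K) ^ n = (ζ : K) ^ k := by
      have := congrArg (Units.val : Kˣ → K) hl2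
      simpa using this.symm
    have hk1 : 1 ≤ k := by
      by_contra hk0
      obtain rfl : k = 0 := by omega
      rw [pow_zero, sub_eq_self] at hk
      exact pow_ne_zero n ζ.ne_zero hk
    obtain ⟨f, hf⟩ := h7 n k (by omega) (by omega) hk1 (by omega) hk
    rw [map_mul, map_inv, mul_inv_eq_one] at hf
    simp only [map_mul, wRζ, hmod, hwR] at hf
    rw [Int.emod_eq_of_lt (by omega) hlt, Int.emod_eq_of_lt (by omega) hlk, Int.toNat_natCast,
      Int.toNat_natCast] at hf
    exact ⟨k, _, hf⟩

/-- Every element of the presented group has a Bruhat normal form. -/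
theorem isBruhat_presentedGroup (hK : Nat.card K = (p ^ m) ^ 2) {h : ℕ} (hq : p ^ m = 2 * h + 1)
    (hh : 0 < h) {ζ : Kˣ} (hζ : ∀ x : Kˣ, x ∈ Subgroup.zpowers ζ)
    (g : PresentedGroup (relators (p ^ m) ζ)) :
    IsBruhat (PresentedGroup.mk _ wb) (PresentedGroup.mk _ wa) (PresentedGroup.mk _ wT)
      (PresentedGroup.mk _ wJ) g := by
  have H := zRelations_presentedGroup hK hq hh hζ
  have hh' : (0 : ℤ) < h := Int.natCast_pos.2 hh
  -- The stronger claim that left multiplication by `g` preserves normal forms passes to products,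
  -- so it can be proved by induction on words.
  suffices hs : ∀ y, IsBruhat (PresentedGroup.mk _ wb) (PresentedGroup.mk _ wa)
      (PresentedGroup.mk _ wT) (PresentedGroup.mk _ wJ) y →
      IsBruhat (PresentedGroup.mk _ wb) (PresentedGroup.mk _ wa) (PresentedGroup.mk _ wT)
        (PresentedGroup.mk (relators (p ^ m) ζ) wJ) (g * y) by
    have h1 := hs 1 (Or.inl (Or.inl ⟨0, (torusElt_zero _ _).symm⟩))
    rwa [mul_one] at h1
  induction g using PresentedGroup.induction_on with
  | _ w =>
    induction w using FreeGroup.induction_on with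
    | C1 => intro y hy; rwa [map_one, one_mul]
    | of x =>
      intro y hy
      cases x with
      | a =>
        have := hy.torusElt_mul H (-1)
        rwa [torusElt_neg_one] at this
      | T => exact hy.T_mul H hh'
      | J => exact hy.J_mul H hh'
    | inv_of x _ =>
      intro y hy
      rw [map_inv]
      cases x with
      | a =>
        obtain ⟨e, he⟩ := H.exists_torusElt_eq_inv
        have := hy.torusElt_mul H e
        rwa [he] at this
      | T =>
        have h1 := hy.T_mul H hh'
        have h2 := inv_eq_of_mul_eq_one_left H.T_sq
        change IsBruhat _ _ _ _ ((PresentedGroup.mk _ wT)⁻¹ * y)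
        rwa [h2]
      | J =>
        have h1 := hy.J_mul H hh'
        have h2 := inv_eq_of_mul_eq_one_left H.J_sq
        change IsBruhat _ _ _ _ ((PresentedGroup.mk _ wJ)⁻¹ * y)
        rwa [h2]
    | mul v w hv hw =>
      intro y hy
      rw [map_mul, mul_assoc]
      exact hv _ (hw _ hy)

/-- The action of the presented group on the projective line. -/
noncomputable def presentedPerm (hK : Nat.card K = (p ^ m) ^ 2) {h : ℕ} (hq : p ^ m = 2 * h + 1)
    (hh : 0 < h) {ζ : Kˣ} (hζ : ∀ x : Kˣ, x ∈ Subgroup.zpowers ζ) :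
    PresentedGroup (relators (p ^ m) ζ) →* Equiv.Perm (OnePoint K) :=
  PresentedGroup.toGroup fun _ hr => lift_relator hK hq hh hζ hr

section

variable (hK : Nat.card K = (p ^ m) ^ 2) {h : ℕ} (hq : p ^ m = 2 * h + 1)
    (hh : 0 < h) {ζ : Kˣ} (hζ : ∀ x : Kˣ, x ∈ Subgroup.zpowers ζ)

theorem presentedPerm_of (x : Gen) :
    presentedPerm hK hq hh hζ (PresentedGroup.of x) = genPerm hK ζ x :=
  PresentedGroup.toGroup.of _

theorem presentedPerm_mk (w : FreeGroup Gen) :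
    presentedPerm hK hq hh hζ (PresentedGroup.mk _ w) = FreeGroup.lift (genPerm hK ζ) w := rfl

theorem presentedPerm_torusElt (e : ℤ) :
    presentedPerm hK hq hh hζ (torusElt (PresentedGroup.mk _ wb) (PresentedGroup.mk _ wa) e) =
      torusPerm hK ζ e := by
  have hpos : (0 : ℤ) < 4 * h * (h + 1) := by positivity
  have hmod : (((p ^ m : ℕ) : ℤ) ^ 2 - 1) = 4 * h * (h + 1) := by rw [hq]; push_cast; ring
  have h1 : torusElt (PresentedGroup.mk (relators (p ^ m) ζ) wb) (PresentedGroup.mk _ wa) e =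
      PresentedGroup.mk _ (wRζ (p ^ m) e) := by
    rw [wRζ, mk_wR, hmod, Int.toNat_of_nonneg (Int.emod_nonneg _ hpos.ne'),
      (zRelations_presentedGroup hK hq hh hζ).torusElt_emod]
  rw [h1, presentedPerm_mk, lift_wRζ hK hq hh hζ]

/-- One point disposes of each kind of normal form. `x J y` moves `∞`, since `x` and `y` fix it and
`J` does not. `h T h'` moves `0`, sending it to some `ζ ^ e`. A torus element sends `1` to `ζ ^ e`,
so it acts trivially only if `q² - 1` divides `e`, and then it is already trivial by the relations.
-/
theorem presentedPerm_injective : Function.Injective (presentedPerm hK hq hh hζ) := by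
  have H := zRelations_presentedGroup hK hq hh hζ
  have hT : presentedPerm hK hq hh hζ (PresentedGroup.mk _ wT) = semiPerm hK (matT K) := by
    rw [presentedPerm_mk, lift_wT]
  have hJ : presentedPerm hK hq hh hζ (PresentedGroup.mk _ wJ) = semiPerm hK (matJ K) := by
    rw [presentedPerm_mk, lift_wJ]
  have htor := presentedPerm_torusElt hK hq hh hζ
  have hB : ∀ x, IsBorel (PresentedGroup.mk _ wb) (PresentedGroup.mk _ wa)
      (PresentedGroup.mk _ wT) x → presentedPerm hK hq hh hζ x ∞ = ∞ := by
    rintro x (⟨e, rfl⟩ | ⟨e, f, rfl⟩)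
    · rw [htor, torusPerm_infty]
    · simp only [map_mul, htor, hT, Equiv.Perm.mul_apply, torusPerm_infty, semiPerm_matT_infty]
  rw [injective_iff_map_eq_one]
  intro g hg
  obtain (⟨e, rfl⟩ | ⟨e, f, rfl⟩) | ⟨x, y, hx, hy, rfl⟩ := isBruhat_presentedGroup hK hq hh hζ g
  · refine H.torusElt_of_dvd ?_
    rw [← zpow_eq_one_iff_dvd_of_generator hK hq hζ]
    have h1 := torusPerm_one hK ζ e
    rw [← htor, hg, Equiv.Perm.one_apply, OnePoint.coe_eq_coe] at h1
    exact Units.ext h1.symm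
  · have h0 := congrArg (fun f : Equiv.Perm (OnePoint K) => f (0 : K)) hg
    simp only [map_mul, htor, hT, Equiv.Perm.mul_apply, torusPerm_zero, semiPerm_matT_coe,
      sub_zero, torusPerm_one, Equiv.Perm.one_apply, OnePoint.coe_eq_coe] at h0
    exact absurd h0 (Units.ne_zero _)
  · have h0 := congrArg (fun f : Equiv.Perm (OnePoint K) => f ∞) hg
    simp only [map_mul, hJ, Equiv.Perm.mul_apply, hB y hy, semiPerm_matJ_infty,
      Equiv.Perm.one_apply] at h0
    exact absurd ((presentedPerm hK hq hh hζ x).injective (h0.trans (hB x hx).symm))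
      (OnePoint.coe_ne_infty _)

theorem range_presentedPerm : (presentedPerm hK hq hh hζ).range = M hK := by
  have hle : (presentedPerm hK hq hh hζ).range ≤ M hK := by
    rw [MonoidHom.range_eq_map, ← PresentedGroup.closure_range_of, MonoidHom.map_closure,
      Subgroup.closure_le]
    rintro _ ⟨_, ⟨x, rfl⟩, rfl⟩
    rw [presentedPerm_of]
    cases x <;> exact semiPerm_mem_M hK _
  refine eq_M_of_standard_mem hK hle (fun u => ?_) ⟨PresentedGroup.of Gen.T, presentedPerm_of ..⟩
    ⟨PresentedGroup.of Gen.J, presentedPerm_of ..⟩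
  -- Primitivity of `ζ` makes the torus words cover every `R(u)`.
  obtain ⟨e, rfl⟩ := Subgroup.mem_zpowers_iff.1 (hζ u)
  exact ⟨_, presentedPerm_torusElt hK hq hh hζ e⟩

end

end Presentation

end Zassenhaus

open Zassenhaus in
/-- For `q = p ^ m` an odd prime power, `K` a field of order `q²` and `ζ` a primitive element of
`K`: `M(q²)` is sharply `3`-transitive on `ℙ¹(K)`; replacing `ω` by `β(ω)` in Möbius
transformations is an isomorphism of the deformation of `PGL₂(K)` along `φ̄` onto `M(q²)`; and the
group presented by the symbols `a, T, J` and the relators is isomorphic to that deformation, with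
`a, T, J` corresponding to the classes of `R(ζ⁻¹)`, `!![1, -1; 0, -1]`, `!![0, -1; -1, 0]`. -/
theorem theorem6p14 (p m : ℕ) [Fact p.Prime] (hp : p ≠ 2) (hm : 1 ≤ m)
    (K : Type*) [Field K] (hK : Nat.card K = (p ^ m) ^ 2)
    (ζ : Kˣ) (hζ : ∀ x : Kˣ, x ∈ Subgroup.zpowers ζ) :
    IsSharplyThreeTransitive (M hK) ∧
    (∃ Φ : Deformation (phiBar hK) ≃* M hK, ∀ (A : Matrix.GeneralLinearGroup (Fin 2) K)
        (ω : OnePoint K),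
        (Φ (Deformation.of (phiBar hK) (Matrix.ProjGenLinGroup.mk A)) : Equiv.Perm (OnePoint K)) ω
          = semiMoebius hK A ω) ∧
    (∃ Ψ : PresentedGroup (relators (p ^ m) ζ) ≃* Deformation (phiBar hK),
        Ψ (PresentedGroup.of Gen.a) =
          Deformation.of (phiBar hK) (Matrix.ProjGenLinGroup.mk (matR ζ⁻¹)) ∧
        Ψ (PresentedGroup.of Gen.T) =
          Deformation.of (phiBar hK) (Matrix.ProjGenLinGroup.mk (matT K)) ∧
        Ψ (PresentedGroup.of Gen.J) =
          Deformation.of (phiBar hK) (Matrix.ProjGenLinGroup.mk (matJ K))) := by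
  have hodd : Odd (p ^ m) := (Fact.out : p.Prime).odd_of_ne_two hp |>.pow
  obtain ⟨h, hq⟩ := hodd
  have hh : 0 < h := by
    have h1 : 1 < p ^ m := Nat.one_lt_pow (by omega) (Fact.out : p.Prime).one_lt
    omega
  obtain ⟨Φ, hΦ⟩ := exists_deformation_mulEquiv_M hK
  refine ⟨isSharplyThreeTransitive_M hK, ⟨Φ, fun A ω => by rw [hΦ, semiPerm_apply]⟩, ?_⟩
  -- The presented group and the deformation are both identified with `M(q²)`, so generators
  -- correspond as soon as their permutations agree.
  let Θ : PresentedGroup (relators (p ^ m) ζ) ≃* M hK :=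
    (MonoidHom.ofInjective (presentedPerm_injective hK hq hh hζ)).trans
      (MulEquiv.subgroupCongr (range_presentedPerm hK hq hh hζ))
  have hΘ : ∀ (x : Gen) (A : Matrix.GeneralLinearGroup (Fin 2) K), genPerm hK ζ x = semiPerm hK A →
      (Θ.trans Φ.symm) (PresentedGroup.of x) =
        Deformation.of (phiBar hK) (Matrix.ProjGenLinGroup.mk A) := by
    intro x A hA
    rw [MulEquiv.trans_apply, MulEquiv.symm_apply_eq]
    exact Subtype.ext ((presentedPerm_of hK hq hh hζ x).trans (hA.trans (hΦ A).symm))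
  exact ⟨Θ.trans Φ.symm, hΘ _ _ rfl, hΘ _ _ rfl, hΘ _ _ rfl⟩
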